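/- For each $N\ge 1$ consider the following network GAB(1,1) model with $N$ units, on its own probability space. Let $W=W^{(N)}$ be an $N\times N$ row-normalized adjacency matrix, i.e. $W_{ij}=A_{ij}/\sum_k A_{ik}$ for a matrix $A$ with entries in $\{0,1\}$ (self-loops allowed) and no zero row. The initial probabilities $(p_{1,0},\dots,p_{N,0})$ form a random vector in $[0,1]^N$, the errors $u_{i,t}$ ($1\le i\le N$, $t\ge 0$) are i.i.d. uniform on $[0,1]$ and independent of the initial probabilities, and for $t\ge 0$ $$y_{i,t}=\mathbf 1\{u_{i,t}\le p_{i,t}\},\qquad p_{i,t+1}=\omega_i+\alpha_i y_{i,t}+\gamma\sum_{j=1}^N W_{ij}\,y_{j,t}+\beta\, p_{i,t},$$ where $\omega_i,\alpha_i,\gamma,\beta\ge 0$ and $\omega_i+\alpha_i+\gamma+\beta\le 1$ for all $i$, and $\beta,\gamma$ depend neither on $i$ nor on $N$. Suppose that $W$ is doubly stochastic and that for some $d>0$ independent of $N$ all out-degrees $d_i^{out}=\#\{j: W_{ij}\ne 0\}$ satisfy $d_i^{out}\ge d\log N$. Suppose that $\omega_i=c_i/N$ and $\alpha_i=a_i/N^{\kappa}$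 with a fixed $\kappa>0$ and $0\le c_i,a_i\le C$, where $C<\infty$ is independent of $i$ and $N$ (the $c_i,a_i$ may depend on $N$), and that the limit $\bar c=\lim_{N\to\infty}\frac1N\sum_{i=1}^N c_i$ exists. Suppose finally that, for an integrable random variable $\lambda_0$, $$\sum_{i=1}^N p_{i,0}\xrightarrow{d}\lambda_0,\qquad \sum_{i=1}^N\mathbb E\,p_{i,0}\to\mathbb E\lambda_0,\qquad \max_{1\le i\le N}p_{i,0}\xrightarrow{p}0\qquad (N\to\infty).$$ Let $X_t(N)=\sum_{i=1}^N y_{i,t}$. Then, as $N\to\infty$, the process $[X_t(N)]_{t\ge 0}$ converges in finite-dimensional distributions to a process $[X_t]_{t\ge 0}$ for which there is a process $[\lambda_t]_{t\ge 0}$ on the same probability space, whose value at $t=0$ has the law of the given $\lambda_0$, such that 1. for every $t\ge 0$, conditionally on $\sigma(\lambda_0,X_0,\dots,X_{t-1})$ (on $\sigma(\lambda_0)$ if $t=0$), $X_t$ has the Poisson distribution with mean $\lambda_t$; 2. $\lambda_t=\bar c+\gamma X_{t-1}+\beta\lambda_{t-1}$ almost surely for every $t\ge 1$; 3. $\lambda_t$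 is the limit of $\sum_{i=1}^N p_{i,t}$, in the sense that $\big[\big(X_t(N),\sum_{i=1}^N p_{i,t}\big)\big]_{t\ge 0}$ converges in finite-dimensional distributions to $[(X_t,\lambda_t)]_{t\ge 0}$. -/

import Mathlib

open MeasureTheory ProbabilityTheory Filter Topology

/-- The out-degree of the vertex `i` in the network with weight matrix `W`: the number of
`j` with `W i j ≠ 0`. -/
noncomputable def outDegree {N : ℕ} (W : Matrix (Fin N) (Fin N) ℝ) (i : Fin N) : ℕ :=
  Set.ncard {j : Fin N | W i j ≠ 0}

/-- `W` is a row-normalized adjacency matrix: it is obtained from the adjacency matrix `A`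
(with entries `0` and `1`) of a directed graph on `N` vertices, in which every vertex has at
least one outgoing link, by dividing each row by its sum. Self-loops are allowed, so that the
matrix with all entries `1 / N` is of this kind. -/
def IsRowNormalizedAdjacency {N : ℕ} (W : Matrix (Fin N) (Fin N) ℝ) : Prop :=
  ∃ A : Matrix (Fin N) (Fin N) ℝ, (∀ i j, A i j = 0 ∨ A i j = 1) ∧ (∀ i, 0 < ∑ k, A i k) ∧
    ∀ i j, W i j = A i j / ∑ k, A i k

/-- The network GAB(1,1) model with `N` units on a probability space `(Ω, μ)`, started at
time `0`, with intercepts `w i` and coefficients `a i`, `g i`, `b i`.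

* `p t i` is the success probability of unit `i` at time `t`,
* `y t i` is the outcome in `{0, 1}`, equal to `1` exactly when `u t i ≤ p t i`,
* the errors `u t i` are i.i.d. uniform on `[0, 1]`, over all units and all times `t ≥ 0`,
  and the whole family of errors is independent of the (random) initial probabilities `p 0`. -/
structure IsNetworkGAB {N : ℕ} {Ω : Type*} [MeasurableSpace Ω] (μ : Measure Ω)
    (w a g b : Fin N → ℝ) (W : Matrix (Fin N) (Fin N) ℝ)
    (p y u : ℕ → Fin N → Ω → ℝ) : Prop where
  w_nonneg : ∀ i, 0 ≤ w i
  a_nonneg : ∀ i, 0 ≤ a i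
  g_nonneg : ∀ i, 0 ≤ g i
  b_nonneg : ∀ i, 0 ≤ b i
  sum_le_one : ∀ i, w i + a i + g i + b i ≤ 1
  network : IsRowNormalizedAdjacency W
  measurable_init : ∀ i, Measurable (p 0 i)
  init_mem : ∀ i x, p 0 i x ∈ Set.Icc (0 : ℝ) 1
  measurable_error : ∀ t i, Measurable (u t i)
  error_uniform : ∀ t i, μ.map (u t i) = volume.restrict (Set.Icc (0 : ℝ) 1)
  error_indep : iIndepFun (fun k : ℕ × Fin N => u k.1 k.2) μ
  init_indep : IndepFun (fun x (i : Fin N) => p 0 i x)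
    (fun x (k : ℕ × Fin N) => u k.1 k.2 x) μ
  outcome : ∀ t i x, y t i x = if u t i x ≤ p t i x then 1 else 0
  prob_succ : ∀ t i x,
    p (t + 1) i x = w i + a i * y t i x + g i * ∑ j, W i j * y t j x + b i * p t i x

/-- The information available before time `t` in the limit: the σ-algebra generated by
`X 0, …, X (t - 1)` and the initial intensity `lam0` (only `lam0` when `t = 0`). -/
@[reducible] def pastInfo {Ω : Type*} (X : ℕ → Ω → ℕ) (lam0 : Ω → ℝ) (t : ℕ) : MeasurableSpace Ω :=
  MeasurableSpace.comap lam0 inferInstance ⊔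
    ⨆ s : Fin t, MeasurableSpace.comap (X s) inferInstance

/-- `(X, lam)` is a Poisson autoregression (INGARCH(1,1)) with parameters `c`, `γ`, `β`: for
every `t ≥ 0`, conditionally on `X 0, …, X (t - 1)` and `lam 0`, the count `X t` has the
Poisson distribution with mean `lam t`, and
`lam (t + 1) = c + γ * X t + β * lam t`. -/
structure IsPoissonAutoregression {Ω : Type*} [MeasurableSpace Ω] (μ : Measure Ω)
    (X : ℕ → Ω → ℕ) (lam : ℕ → Ω → ℝ) (c γ β : ℝ) : Prop where
  measurable_count : ∀ t, Measurable (X t)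
  measurable_intensity : ∀ t, Measurable (lam t)
  intensity_nonneg : ∀ t, ∀ᵐ x ∂μ, 0 ≤ lam t x
  cond_poisson : ∀ t n, μ⟦X t ⁻¹' {n} | pastInfo X (lam 0) t⟧ =ᵐ[μ]
    fun x => (poissonMeasure (lam t x).toNNReal).real {n}
  intensity_succ : ∀ t, ∀ᵐ x ∂μ, lam (t + 1) x = c + γ * (X t x : ℝ) + β * lam t x

/-- Convergence in finite-dimensional distributions of the processes `Y N`, each on its own
probability space, to the process `Z` as `N → ∞`: for every finite set `I` of times, the
vectors `(Y N t)_{t ∈ I}` converge in distribution to `(Z t)_{t ∈ I}`. -/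
def TendstoFDD {E : Type*} [TopologicalSpace E] [SecondCountableTopology E]
    [MeasurableSpace E] [BorelSpace E]
    {Ω : ℕ → Type*} [∀ N, MeasurableSpace (Ω N)] {Ω' : Type*} [MeasurableSpace Ω']
    (Y : (N : ℕ) → ℕ → Ω N → E) (Z : ℕ → Ω' → E)
    (P : (N : ℕ) → Measure (Ω N)) [∀ N, IsProbabilityMeasure (P N)]
    (Q : Measure Ω') [IsProbabilityMeasure Q] : Prop :=
  ∀ I : Finset ℕ, TendstoInDistribution
    (fun N x (t : I) => Y N t x) atTop (fun x (t : I) => Z t x) P Q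

/-! The proof is a law of small numbers carried through time. Given the initial probabilities and
the errors before time `T`, the outcomes at time `T` are independent Bernoulli variables with
parameters `p T i`. Hence their total has conditional characteristic function `∏ (1 + p T i * (exp
(iθ) - 1))`, which differs from the Poisson one, `exp (∑ p T i * (exp (iθ) - 1))`, by at most `8 *
max p * ∑ p`. This error vanishes in probability when the maximum does, because a total that
converges in distribution is tight.

Two facts restore the hypotheses at the next time. Unit column sums give `∑ p (T + 1) i = ∑ ω i + ∑
α i * y T i + γ * ∑ y T i + β * ∑ p T i`, where the first term tends to `cbar` and the second is at
most `C / N ^ κ` times a tight total (`smallInProb_sum_p_succ_sub`). Weights are at most one over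
the out-degree, so neighbour averages are at most `∑ y T i / (d * log N)` and the maximum stays
small (`smallInProb_iSup_succ`).

The induction therefore carries two statements: joint convergence of the totals before `T` with `∑ p
T i`, and smallness of the maximum at `T`. The Poisson step is `tendstoInDistribution_totals_succ`;
the intensity step is Slutsky's theorem. The limit is built explicitly from an initial value and
independent uniforms, so that its conditional laws follow from Fubini's theorem. -/

/-! ### Smallness in probability and Slutsky's theorem on varying spaces -/

section SmallInProb

/-- The random variables `M N`, each on its own probability space, are eventually smaller than
any `ε > 0` with probability tending to one. -/
def SmallInProb {Ω : ℕ → Type*} [∀ N, MeasurableSpace (Ω N)] (P : (N : ℕ) → Measure (Ω N))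
    (M : (N : ℕ) → Ω N → ℝ) : Prop :=
  ∀ ε : ℝ, 0 < ε → Tendsto (fun N => P N {x | ε ≤ M N x}) atTop (𝓝 0)

variable {Ω : ℕ → Type*} [∀ N, MeasurableSpace (Ω N)] {P : (N : ℕ) → Measure (Ω N)}
  {M M' : (N : ℕ) → Ω N → ℝ}

lemma SmallInProb.mono (h : SmallInProb P M) (hM : ∀ᶠ N in atTop, ∀ x, M' N x ≤ M N x) :
    SmallInProb P M' := by
  intro ε hε
  refine tendsto_of_tendsto_of_tendsto_of_le_of_le' tendsto_const_nhds (h ε hε)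
    (Eventually.of_forall fun _ => zero_le) ?_
  filter_upwards [hM] with N hN
  exact measure_mono fun x hx => le_trans hx (hN x)

lemma SmallInProb.add (h : SmallInProb P M) (h' : SmallInProb P M') :
    SmallInProb P (fun N x => M N x + M' N x) := by
  intro ε hε
  have := (h (ε / 2) (by positivity)).add (h' (ε / 2) (by positivity))
  rw [add_zero] at this
  refine tendsto_of_tendsto_of_tendsto_of_le_of_le tendsto_const_nhds this
    (fun _ => zero_le) fun N => ?_
  refine (measure_mono fun x (hx : ε ≤ M N x + M' N x) => ?_).trans (measure_union_le _ _)
  by_contra hcon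
  simp only [Set.mem_union, Set.mem_ofPred_eq, not_or, not_le] at hcon
  linarith [hcon.1, hcon.2]

lemma smallInProb_of_tendsto {r : ℕ → ℝ} (hr : Tendsto r atTop (𝓝 0)) :
    SmallInProb P (fun N _ => r N) := by
  intro ε hε
  refine tendsto_const_nhds.congr' ?_
  filter_upwards [hr.eventually_lt_const hε] with N hN
  simp [not_le.2 hN]

lemma SmallInProb.const_mul (h : SmallInProb P M) {K : ℝ} (hK : 0 ≤ K) :
    SmallInProb P (fun N x => K * M N x) := by
  rcases hK.eq_or_lt with rfl | hK
  · simpa using smallInProb_of_tendsto (P := P) (r := fun _ => 0) tendsto_const_nhds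
  intro ε hε
  convert h (ε / K) (by positivity) using 5 with N x
  rw [div_le_iff₀' hK]

variable [∀ N, IsProbabilityMeasure (P N)] {Ω' : Type*} [MeasurableSpace Ω'] {Q : Measure Ω'}
  [IsProbabilityMeasure Q]

/-- Upper tightness: the limit law gives little mass to a far half-line, and the portmanteau
inequality for closed sets passes this to large `N`. -/
lemma exists_eventually_measure_ge_le {Z : (N : ℕ) → Ω N → ℝ} {Z' : Ω' → ℝ}
    (h : TendstoInDistribution Z atTop Z' P Q) {δ : ENNReal} (hδ : 0 < δ) :
    ∃ K : ℝ, 0 < K ∧ ∀ᶠ N in atTop, P N {x | K ≤ Z N x} ≤ δ := by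
  have hlim : Tendsto (fun n : ℕ => (Q.map Z') (Set.Ici ((n : ℝ) + 1))) atTop (𝓝 0) := by
    have := Measure.isProbabilityMeasure_map h.aemeasurable_limit
    have hemp : (⋂ n : ℕ, Set.Ici ((n : ℝ) + 1)) = ∅ := by
      ext x
      simp only [Set.mem_iInter, Set.mem_Ici, Set.mem_empty_iff_false, iff_false, not_forall,
        not_le]
      obtain ⟨n, hn⟩ := exists_nat_gt x
      exact ⟨n, by linarith⟩
    rw [← measure_empty (μ := Q.map Z'), ← hemp]
    refine tendsto_measure_iInter_atTop (fun n => measurableSet_Ici.nullMeasurableSet) ?_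
      ⟨0, measure_ne_top _ _⟩
    intro m n hmn
    exact Set.Ici_subset_Ici.2 (by have : (m : ℝ) ≤ n := by exact_mod_cast hmn
                                   linarith)
  obtain ⟨n, hn⟩ := (hlim.eventually_lt_const hδ).exists
  refine ⟨n + 1, by positivity, ?_⟩
  have hls := ProbabilityMeasure.limsup_measure_closed_le_of_tendsto h.tendsto
    (F := Set.Ici ((n : ℝ) + 1)) isClosed_Ici
  have hev := eventually_lt_of_limsup_lt (hls.trans_lt hn)
  filter_upwards [hev] with N hN
  have h2 := hN.le
  simp only [ProbabilityMeasure.coe_mk] at h2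
  rw [Measure.map_apply_of_aemeasurable (h.forall_aemeasurable N) measurableSet_Ici] at h2
  exact h2

lemma SmallInProb.mul_tendstoInDistribution (h : SmallInProb P M)
    {Z : (N : ℕ) → Ω N → ℝ} {Z' : Ω' → ℝ} (hZ : TendstoInDistribution Z atTop Z' P Q)
    (hZ0 : ∀ N x, 0 ≤ Z N x) : SmallInProb P (fun N x => M N x * Z N x) := by
  intro ε hε
  rw [ENNReal.tendsto_nhds_zero]
  intro δ hδ
  obtain ⟨K, hK, hev⟩ := exists_eventually_measure_ge_le hZ (ENNReal.half_pos hδ.ne')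
  have h2 := (ENNReal.tendsto_nhds_zero.1 (h (ε / K) (by positivity))) _ (ENNReal.half_pos hδ.ne')
  filter_upwards [hev, h2] with N h1 h2
  calc P N {x | ε ≤ M N x * Z N x}
      ≤ P N ({x | ε / K ≤ M N x} ∪ {x | K ≤ Z N x}) := by
        refine measure_mono fun x (hx : ε ≤ M N x * Z N x) => ?_
        by_contra hcon
        simp only [Set.mem_union, Set.mem_ofPred_eq, not_or, not_le] at hcon
        have h3 : M N x * Z N x ≤ ε / K * Z N x :=
          mul_le_mul_of_nonneg_right hcon.1.le (hZ0 N x)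
        have h4 : ε / K * Z N x < ε / K * K := mul_lt_mul_of_pos_left hcon.2 (by positivity)
        rw [div_mul_cancel₀ _ hK.ne'] at h4
        linarith
    _ ≤ δ / 2 + δ / 2 := (measure_union_le _ _).trans (add_le_add h2 h1)
    _ = δ := ENNReal.add_halves δ

/-- Bounded convergence without a common probability space: the integrand is below `ε` off a set of
vanishing probability, and at most `B` on it. -/
lemma tendsto_integral_of_smallInProb {D : (N : ℕ) → Ω N → ℂ} {B : ℝ}
    (hDm : ∀ N, AEStronglyMeasurable (D N) (P N)) (hD : ∀ N x, ‖D N x‖ ≤ B)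
    (h : SmallInProb P (fun N x => ‖D N x‖)) :
    Tendsto (fun N => ∫ x, D N x ∂(P N)) atTop (𝓝 0) := by
  have hB : 0 ≤ B := by
    have : Nonempty (Ω 0) := nonempty_of_isProbabilityMeasure (P 0)
    exact (norm_nonneg _).trans (hD 0 (Classical.arbitrary _))
  have hbd : ∀ ε : ℝ, 0 < ε → ∀ N, ‖∫ x, D N x ∂(P N)‖ ≤
      ε + B * (P N {x | ε ≤ ‖D N x‖}).toReal := by
    intro ε hε N
    have hms : NullMeasurableSet {x | ε ≤ ‖D N x‖} (P N) :=
      nullMeasurableSet_le aemeasurable_const (hDm N).norm.aemeasurable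
    have hi : Integrable ({x | ε ≤ ‖D N x‖}.indicator fun _ => B) (P N) :=
      (integrable_const B).indicator₀ hms
    calc ‖∫ x, D N x ∂(P N)‖ ≤ ∫ x, ‖D N x‖ ∂(P N) := norm_integral_le_integral_norm _
      _ ≤ ∫ x, (ε + {x | ε ≤ ‖D N x‖}.indicator (fun _ => B) x) ∂(P N) := by
          refine integral_mono_of_nonneg (Eventually.of_forall fun _ => norm_nonneg _)
            ((integrable_const ε).add hi) (Eventually.of_forall fun x => ?_)
          by_cases hx : ε ≤ ‖D N x‖
          · simp only [Set.indicator, Set.mem_ofPred_eq, hx, if_true]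
            linarith [hD N x]
          · simp only [Set.indicator, Set.mem_ofPred_eq, hx, if_false]
            linarith
      _ = ε + B * (P N {x | ε ≤ ‖D N x‖}).toReal := by
          rw [integral_add (integrable_const ε) hi, integral_indicator₀ hms]
          simp [Measure.real, mul_comm]
  rw [tendsto_zero_iff_norm_tendsto_zero, Metric.tendsto_nhds]
  intro ε hε
  have h1 := (ENNReal.tendsto_toReal ENNReal.zero_ne_top).comp (h (ε / 2) (by positivity))
  have h2 := h1.const_mul B
  simp only [ENNReal.toReal_zero, mul_zero] at h2
  filter_upwards [h2.eventually_lt_const (half_pos hε)] with N hN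
  rw [Real.dist_eq, sub_zero, abs_norm]
  have := hbd (ε / 2) (by positivity) N
  simp only [Function.comp] at hN
  linarith

/-- **Slutsky's theorem** for random variables that live on varying probability spaces. -/
lemma MeasureTheory.TendstoInDistribution.of_smallInProb_sub {E : Type*} [SeminormedAddCommGroup E]
    [SecondCountableTopology E] [MeasurableSpace E] [BorelSpace E]
    {X Y : (N : ℕ) → Ω N → E} {Z : Ω' → E} (hX : TendstoInDistribution X atTop Z P Q)
    (hY : ∀ N, AEMeasurable (Y N) (P N))
    (hXY : SmallInProb P (fun N x => ‖Y N x - X N x‖)) :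
    TendstoInDistribution Y atTop Z P Q := by
  have hZ := hX.aemeasurable_limit
  have hXm := hX.forall_aemeasurable
  refine ⟨hY, hZ, ?_⟩
  refine tendsto_iff_forall_lipschitz_integral_tendsto.2 ?_
  rintro F ⟨B, hB⟩ ⟨L, hL⟩
  have hXF := (tendsto_iff_forall_lipschitz_integral_tendsto.1 hX.tendsto) F ⟨B, hB⟩ ⟨L, hL⟩
  have hFc : Continuous F := hL.continuous
  simp only [ProbabilityMeasure.coe_mk] at hXF ⊢
  have hm : ∀ {W : (N : ℕ) → Ω N → E}, (∀ N, AEMeasurable (W N) (P N)) → ∀ N,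
      ∫ x, F x ∂((P N).map (W N)) = ∫ x, F (W N x) ∂(P N) := fun hW N =>
    integral_map (hW N) hFc.aestronglyMeasurable
  simp only [hm hXm, hm hY] at hXF ⊢
  -- Boundedness of `F` is given as a bound `B` on its oscillation, so the value at `0` serves as
  -- reference point.
  have hint : ∀ {W : (N : ℕ) → Ω N → E}, (∀ N, AEMeasurable (W N) (P N)) → ∀ N,
      Integrable (fun x => F (W N x)) (P N) := fun {W} hW N =>
    Integrable.of_bound (hFc.measurable.comp_aemeasurable (hW N)).aestronglyMeasurable
      (‖F 0‖ + B) (Eventually.of_forall fun x => by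
        have h1 : ‖F (W N x) - F 0‖ ≤ B := by simpa [dist_eq_norm] using hB (W N x) 0
        linarith [norm_sub_norm_le (F (W N x)) (F 0)])
  have hdiff : Tendsto (fun N => ∫ x, ((F (Y N x) - F (X N x) : ℝ) : ℂ) ∂(P N)) atTop (𝓝 0) := by
    refine tendsto_integral_of_smallInProb (B := B) (fun N => ?_) (fun N x => ?_) ?_
    · exact (Complex.measurable_ofReal.comp_aemeasurable
        ((hint hY N).aestronglyMeasurable.aemeasurable.sub
          (hint hXm N).aestronglyMeasurable.aemeasurable)).aestronglyMeasurable
    · rw [Complex.norm_real, ← dist_eq_norm]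
      exact hB _ _
    · refine (hXY.const_mul (K := L) L.2).mono (Eventually.of_forall fun N x => ?_)
      rw [Complex.norm_real, ← dist_eq_norm, ← dist_eq_norm]
      exact hL.dist_le_mul _ _
  have hdiff' : Tendsto (fun N => ∫ x, F (Y N x) ∂(P N) - ∫ x, F (X N x) ∂(P N)) atTop (𝓝 0) := by
    have := (Complex.continuous_re.tendsto 0).comp hdiff
    refine this.congr fun N => ?_
    simp only [Function.comp]
    rw [integral_complex_ofReal, Complex.ofReal_re, integral_sub (hint hY N) (hint hXm N)]
  simpa using hdiff'.add hXF

end SmallInProb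

/-! ### Characteristic functions of vectors of pairs -/

section CharacteristicFunction

variable {Ω : ℕ → Type*} [∀ N, MeasurableSpace (Ω N)] {P : (N : ℕ) → Measure (Ω N)}
  [∀ N, IsProbabilityMeasure (P N)] {Ω' : Type*} [MeasurableSpace Ω'] {Q : Measure Ω'}
  [IsProbabilityMeasure Q]

/-- The standard pairing of two vectors of pairs of real numbers. -/
def pairing {ι : Type*} [Fintype ι] (θ z : ι → ℝ × ℝ) : ℝ :=
  ∑ k, ((θ k).1 * (z k).1 + (θ k).2 * (z k).2)

@[fun_prop]
lemma continuous_pairing {ι : Type*} [Fintype ι] (θ : ι → ℝ × ℝ) : Continuous (pairing θ) := by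
  unfold pairing
  fun_prop

/-- A vector of pairs as a point of a Euclidean space. -/
def pairsToEuclidean {ι : Type*} (z : ι → ℝ × ℝ) : EuclideanSpace ℝ (ι ⊕ ι) :=
  WithLp.toLp 2 (Sum.elim (fun k => (z k).1) (fun k => (z k).2))

lemma continuous_pairsToEuclidean {ι : Type*} :
    Continuous (pairsToEuclidean : (ι → ℝ × ℝ) → EuclideanSpace ℝ (ι ⊕ ι)) := by
  refine (PiLp.continuous_toLp 2 _).comp (continuous_pi fun k => ?_)
  rcases k with k | k <;> simp only [Sum.elim_inl, Sum.elim_inr] <;> fun_prop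

lemma charFun_map_pairsToEuclidean {ι : Type*} [Fintype ι] {Ω₁ : Type*} [MeasurableSpace Ω₁]
    (μ : Measure Ω₁) {Y : Ω₁ → ι → ℝ × ℝ} (hY : AEMeasurable Y μ)
    (t : EuclideanSpace ℝ (ι ⊕ ι)) :
    charFun (μ.map (fun x => pairsToEuclidean (Y x))) t
      = ∫ x, Complex.exp (pairing (fun k => (t (Sum.inl k), t (Sum.inr k))) (Y x) *
          Complex.I) ∂μ := by
  have hcomp : AEMeasurable (fun x => pairsToEuclidean (Y x)) μ :=
    continuous_pairsToEuclidean.measurable.comp_aemeasurable hY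
  rw [charFun_apply, integral_map hcomp (Continuous.aestronglyMeasurable (by fun_prop))]
  refine integral_congr_ae (Eventually.of_forall fun x => ?_)
  simp only [pairing, pairsToEuclidean, PiLp.inner_apply, Fintype.sum_sum_type, Sum.elim_inl,
    Sum.elim_inr, Finset.sum_add_distrib, RCLike.inner_apply, conj_trivial]

/-- Convergence of characteristic functions implies convergence in distribution, for random
vectors of pairs. -/
lemma tendstoInDistribution_of_charFun_pairs {ι : Type*} [Fintype ι]
    {Z : (N : ℕ) → Ω N → ι → ℝ × ℝ} {Z' : Ω' → ι → ℝ × ℝ}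
    (hZ : ∀ N, AEMeasurable (Z N) (P N)) (hZ' : AEMeasurable Z' Q)
    (h : ∀ θ : ι → ℝ × ℝ, Tendsto (fun N => ∫ x, Complex.exp (pairing θ (Z N x) * Complex.I) ∂(P N))
      atTop (𝓝 (∫ x, Complex.exp (pairing θ (Z' x) * Complex.I) ∂Q))) :
    TendstoInDistribution Z atTop Z' P Q := by
  have he := (continuous_pairsToEuclidean (ι := ι)).measurable
  have hE : TendstoInDistribution (fun N x => pairsToEuclidean (Z N x)) atTop
      (fun x => pairsToEuclidean (Z' x)) P Q := by
    refine ⟨fun N => he.comp_aemeasurable (hZ N), he.comp_aemeasurable hZ',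
      ProbabilityMeasure.tendsto_of_tendsto_charFun fun t => ?_⟩
    simp only [ProbabilityMeasure.coe_mk, charFun_map_pairsToEuclidean Q hZ' t,
      fun N => charFun_map_pairsToEuclidean (P N) (hZ N) t]
    exact h _
  -- Lévy's theorem was applied in Euclidean space; this continuous left inverse of
  -- `pairsToEuclidean` carries the convergence back.
  have hr : Continuous fun (v : EuclideanSpace ℝ (ι ⊕ ι)) (k : ι) =>
    (v (Sum.inl k), v (Sum.inr k)) := by fun_prop
  exact hE.continuous_comp hr

lemma MeasureTheory.TendstoInDistribution.tendsto_integral {E : Type*} [TopologicalSpace E] [MeasurableSpace E]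
    [OpensMeasurableSpace E] {Z : (N : ℕ) → Ω N → E} {Z' : Ω' → E}
    (h : TendstoInDistribution Z atTop Z' P Q) {G : E → ℂ} (hG : Continuous G) {B : ℝ}
    (hB : ∀ z, ‖G z‖ ≤ B) :
    Tendsto (fun N => ∫ x, G (Z N x) ∂(P N)) atTop (𝓝 (∫ x, G (Z' x) ∂Q)) := by
  have := (ProbabilityMeasure.tendsto_iff_forall_integral_rclike_tendsto ℂ).1 h.tendsto
    (BoundedContinuousFunction.ofNormedAddCommGroup G hG B hB)
  simp only [ProbabilityMeasure.coe_mk, BoundedContinuousFunction.coe_ofNormedAddCommGroup] at this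
  rw [integral_map h.aemeasurable_limit hG.measurable.aestronglyMeasurable] at this
  refine this.congr fun N => ?_
  rw [integral_map (h.forall_aemeasurable N) hG.measurable.aestronglyMeasurable]

end CharacteristicFunction

/-! ### Poisson approximation of Bernoulli sums -/

section PoissonApproximation

lemma norm_prod_le_one {ι : Type*} (s : Finset ι) (f : ι → ℂ) (hf : ∀ i ∈ s, ‖f i‖ ≤ 1) :
    ‖∏ i ∈ s, f i‖ ≤ 1 := by
  rw [norm_prod]
  exact Finset.prod_le_one (fun i _ => norm_nonneg _) hf

/-- Telescoping: factors are exchanged one at a time, and all the others have norm at most one. -/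
lemma norm_prod_sub_prod_le_sum {ι : Type*} (s : Finset ι) (f g : ι → ℂ)
    (hf : ∀ i ∈ s, ‖f i‖ ≤ 1) (hg : ∀ i ∈ s, ‖g i‖ ≤ 1) :
    ‖∏ i ∈ s, f i - ∏ i ∈ s, g i‖ ≤ ∑ i ∈ s, ‖f i - g i‖ := by
  classical
  induction s using Finset.induction_on with
  | empty => simp
  | insert a s ha ih =>
    rw [Finset.prod_insert ha, Finset.prod_insert ha, Finset.sum_insert ha]
    have h1 := ih (fun i hi => hf i (Finset.mem_insert_of_mem hi))
      (fun i hi => hg i (Finset.mem_insert_of_mem hi))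
    have h2 := norm_prod_le_one s f fun i hi => hf i (Finset.mem_insert_of_mem hi)
    have h3 := hg a (Finset.mem_insert_self a s)
    calc ‖f a * ∏ i ∈ s, f i - g a * ∏ i ∈ s, g i‖
        = ‖(f a - g a) * ∏ i ∈ s, f i + g a * (∏ i ∈ s, f i - ∏ i ∈ s, g i)‖ := by ring_nf
      _ ≤ ‖f a - g a‖ * ‖∏ i ∈ s, f i‖ + ‖g a‖ * ‖∏ i ∈ s, f i - ∏ i ∈ s, g i‖ := by
          refine (norm_add_le _ _).trans ?_
          rw [norm_mul, norm_mul]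
      _ ≤ ‖f a - g a‖ * 1 + 1 * ∑ i ∈ s, ‖f i - g i‖ := by gcongr
      _ = _ := by ring

lemma norm_exp_mul_expI_sub_one_le (θ : ℝ) {l : ℝ} (hl : 0 ≤ l) :
    ‖Complex.exp (l * (Complex.exp (θ * Complex.I) - 1))‖ ≤ 1 := by
  rw [Complex.norm_exp, Complex.re_ofReal_mul, Real.exp_le_one_iff]
  refine mul_nonpos_of_nonneg_of_nonpos hl ?_
  have := Complex.re_le_norm (Complex.exp (θ * Complex.I))
  rw [Complex.norm_exp_ofReal_mul_I] at this
  simpa using this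

lemma norm_one_add_mul_expI_sub_one_le (θ : ℝ) {q : ℝ} (h0 : 0 ≤ q) (h1 : q ≤ 1) :
    ‖1 + (q : ℂ) * (Complex.exp (θ * Complex.I) - 1)‖ ≤ 1 := by
  have : 1 + (q : ℂ) * (Complex.exp (θ * Complex.I) - 1)
      = ((1 - q : ℝ) : ℂ) + (q : ℂ) * Complex.exp (θ * Complex.I) := by push_cast; ring
  rw [this]
  refine (norm_add_le _ _).trans ?_
  rw [norm_mul, Complex.norm_exp_ofReal_mul_I, Complex.norm_real, Complex.norm_real,
    Real.norm_of_nonneg h0, Real.norm_of_nonneg (by linarith)]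
  linarith

lemma norm_one_add_sub_exp_le (θ : ℝ) {q : ℝ} (h0 : 0 ≤ q) (h1 : q ≤ 1) :
    ‖1 + (q : ℂ) * (Complex.exp (θ * Complex.I) - 1)
      - Complex.exp (q * (Complex.exp (θ * Complex.I) - 1))‖ ≤ 8 * q ^ 2 := by
  set z := Complex.exp (θ * Complex.I) - 1 with hz
  have hz2 : ‖z‖ ≤ 2 := by
    refine (norm_sub_le _ _).trans ?_
    rw [Complex.norm_exp_ofReal_mul_I]
    norm_num
  have hqz : ‖(q : ℂ) * z‖ ≤ 2 * q := by
    rw [norm_mul, Complex.norm_real, Real.norm_of_nonneg h0]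
    nlinarith
  -- For `q ≤ 1 / 2` the second-order Taylor bound gives `‖q * z‖ ^ 2 ≤ 4 * q ^ 2`. For larger `q`
  -- the trivial bound `2` is at most `8 * q ^ 2`, which fixes the constant.
  rcases le_total q (1 / 2) with h | h
  · have := Complex.norm_exp_sub_one_sub_id_le (x := (q : ℂ) * z) (by linarith)
    rw [norm_sub_rev, ← sub_sub]
    refine this.trans ?_
    nlinarith [norm_nonneg ((q : ℂ) * z)]
  · have h2 := norm_one_add_mul_expI_sub_one_le θ h0 h1
    have h3 := norm_exp_mul_expI_sub_one_le θ h0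
    refine (norm_sub_le _ _).trans ?_
    nlinarith

/-- The characteristic function of a sum of independent Bernoulli variables is close to that of
a Poisson variable with the same mean. -/
lemma norm_prod_one_add_sub_exp_le {ι : Type*} [Fintype ι] (θ : ℝ) {q : ι → ℝ} {m : ℝ}
    (h0 : ∀ i, 0 ≤ q i) (h1 : ∀ i, q i ≤ 1) (hm : ∀ i, q i ≤ m) :
    ‖∏ i, (1 + (q i : ℂ) * (Complex.exp (θ * Complex.I) - 1))
      - Complex.exp ((∑ i, q i : ℝ) * (Complex.exp (θ * Complex.I) - 1))‖ ≤
      8 * m * ∑ i, q i := by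
  rw [Complex.ofReal_sum, Finset.sum_mul, Complex.exp_sum]
  refine (norm_prod_sub_prod_le_sum _ _ _
    (fun i _ => norm_one_add_mul_expI_sub_one_le θ (h0 i) (h1 i))
    (fun i _ => norm_exp_mul_expI_sub_one_le θ (h0 i))).trans ?_
  rw [Finset.mul_sum]
  refine Finset.sum_le_sum fun i _ => (norm_one_add_sub_exp_le θ (h0 i) (h1 i)).trans ?_
  nlinarith [h0 i, hm i, mul_le_mul_of_nonneg_left (hm i) (h0 i)]

end PoissonApproximation

/-! ### Independence of the present noise from the past -/

section PastNoise

variable {Ω A B β : Type*} [MeasurableSpace A] [MeasurableSpace B]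

/-- The σ-algebra generated by the initial value `ξ` and the noise variables `V s` with
`s < T`. -/
@[reducible] def pastNoise (ξ : Ω → A) (V : ℕ → Ω → B) (T : ℕ) : MeasurableSpace Ω :=
  MeasurableSpace.comap ξ inferInstance ⊔
    ⨆ s : Fin T, MeasurableSpace.comap (V s) inferInstance

lemma pastNoise_mono (ξ : Ω → A) (V : ℕ → Ω → B) : Monotone (pastNoise ξ V) := by
  intro S T hST
  refine sup_le le_sup_left (iSup_le fun s => le_sup_of_le_right ?_)
  exact le_iSup (fun s : Fin T => MeasurableSpace.comap (V s) inferInstance)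
    ⟨s, s.2.trans_le hST⟩

lemma measurable_init_pastNoise (ξ : Ω → A) (V : ℕ → Ω → B) (T : ℕ) :
    Measurable[pastNoise ξ V T] ξ :=
  (comap_measurable ξ).mono le_sup_left le_rfl

lemma measurable_noise_pastNoise (ξ : Ω → A) (V : ℕ → Ω → B) {s T : ℕ} (h : s < T) :
    Measurable[pastNoise ξ V T] (V s) :=
  (comap_measurable (V s)).mono (le_sup_of_le_right
    (le_iSup (fun s : Fin T => MeasurableSpace.comap (V s) inferInstance) ⟨s, h⟩)) le_rfl

variable [MeasurableSpace β] [mΩ : MeasurableSpace Ω] {μ : Measure Ω}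

lemma pastNoise_le {ξ : Ω → A} {V : ℕ → Ω → B} (hξ : Measurable ξ) (hV : ∀ t, Measurable (V t))
    (T : ℕ) : pastNoise ξ V T ≤ mΩ :=
  sup_le hξ.comap_le (iSup_le fun s => (hV s).comap_le)

/-- A function of the initial value and of the past noise is independent of the present noise. -/
lemma indepFun_of_measurable_pastNoise [IsProbabilityMeasure μ] {ξ : Ω → A} {V : ℕ → Ω → B}
    (hξ : Measurable ξ) (hV : ∀ t, Measurable (V t)) (hVV : iIndepFun V μ)
    (hξV : IndepFun ξ (fun x t => V t x) μ) {T : ℕ} {Y : Ω → β}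
    (hY : Measurable[pastNoise ξ V T] Y) : IndepFun Y (V T) μ := by
  let R : Ω → (Finset.range T → B) := fun x s => V s x
  have hR : Measurable R := by fun_prop
  have hRV : IndepFun R (V T) μ := by
    have := hVV.indepFun_finset (Finset.range T) {T} (by simp) hV
    exact this.comp (φ := id) (ψ := fun f : (({T} : Finset ℕ) → B) =>
      f ⟨T, Finset.mem_singleton_self T⟩) measurable_id (measurable_pi_apply _)
  have hξRV : IndepFun ξ (fun x => (R x, V T x)) μ :=
    hξV.comp (φ := id) (ψ := fun f : ℕ → B => ((fun s : Finset.range T => f s), f T))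
      measurable_id (by fun_prop)
  have hξR : IndepFun ξ R μ := hξRV.comp (φ := id) measurable_id measurable_fst
  have hmain : IndepFun (fun x => (ξ x, R x)) (V T) μ := by
    rw [indepFun_iff_map_prod_eq_prod_map_map (by fun_prop) (by fun_prop)]
    have h1 := (indepFun_iff_map_prod_eq_prod_map_map (by fun_prop) (by fun_prop)).1 hξRV
    have h2 := (indepFun_iff_map_prod_eq_prod_map_map (by fun_prop) (by fun_prop)).1 hRV
    have h3 := (indepFun_iff_map_prod_eq_prod_map_map (by fun_prop) (by fun_prop)).1 hξR
    have : IsProbabilityMeasure (μ.map ξ) := Measure.isProbabilityMeasure_map hξ.aemeasurable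
    have : IsProbabilityMeasure (μ.map R) := Measure.isProbabilityMeasure_map hR.aemeasurable
    have : IsProbabilityMeasure (μ.map (V T)) :=
      Measure.isProbabilityMeasure_map (hV T).aemeasurable
    -- The law of `((ξ, R), V T)` is the product law after reassociation, since `ξ` is independent
    -- of `(R, V T)` and `R` of `V T`.
    rw [h3, ← (measurePreserving_prodAssoc _ _ _).symm.map_eq, ← h2, ← h1,
      Measure.map_map (MeasurableEquiv.measurable _) (by fun_prop)]
    rfl
  have hle : pastNoise ξ V T ≤ MeasurableSpace.comap (fun x => (ξ x, R x)) inferInstance := by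
    refine sup_le ?_ (iSup_le fun s => ?_)
    · exact (measurable_fst.comp (comap_measurable fun x => (ξ x, R x))).comap_le
    · have : Measurable[MeasurableSpace.comap (fun x => (ξ x, R x)) inferInstance] fun x =>
          (ξ x, R x) := comap_measurable _
      exact ((measurable_pi_apply (⟨s, by simp⟩ : Finset.range T)).comp
        (measurable_snd.comp this)).comap_le
  exact indep_of_indep_of_le_left hmain (hY.comap_le.trans hle)

/-- Freezing: under independence the joint law is a product, and Fubini integrates the noise out
with `Y` held fixed. -/
lemma integral_comp_of_indepFun [IsProbabilityMeasure μ] {E : Type*} [NormedAddCommGroup E]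
    [NormedSpace ℝ E] {Y : Ω → β} {V : Ω → B} (hY : Measurable Y) (hV : Measurable V)
    (hYV : IndepFun Y V μ) {g : β × B → E} (hg : StronglyMeasurable g) {K : ℝ}
    (hK : ∀ x, ‖g (Y x, V x)‖ ≤ K) :
    ∫ x, g (Y x, V x) ∂μ = ∫ x, ∫ v, g (Y x, v) ∂(μ.map V) ∂μ := by
  have : IsProbabilityMeasure (μ.map Y) := Measure.isProbabilityMeasure_map hY.aemeasurable
  have : IsProbabilityMeasure (μ.map V) := Measure.isProbabilityMeasure_map hV.aemeasurable
  have hYVm : Measurable fun x => (Y x, V x) := hY.prodMk hV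
  have hlaw := (indepFun_iff_map_prod_eq_prod_map_map hY.aemeasurable hV.aemeasurable).1 hYV
  have hgi : Integrable g ((μ.map Y).prod (μ.map V)) := by
    rw [← hlaw, integrable_map_measure hg.aestronglyMeasurable hYVm.aemeasurable]
    exact Integrable.of_bound (hg.comp_measurable hYVm).aestronglyMeasurable K
      (Eventually.of_forall hK)
  rw [← integral_map (φ := fun x => (Y x, V x)) hYVm.aemeasurable hg.aestronglyMeasurable, hlaw,
    integral_prod _ hgi, integral_map hY.aemeasurable hg.integral_prod_right'.aestronglyMeasurable]

end PastNoise

/-! ### Construction of the limiting Poisson autoregression -/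

section LimitProcess

/-- The Poisson distribution as a Markov kernel in its (truncated) mean. -/
noncomputable def poissonMeanKernel : Kernel ℝ ℕ where
  toFun r := poissonMeasure r.toNNReal
  measurable' := by
    refine Measure.measurable_of_measurable_coe _ fun s hs => ?_
    simp only [poissonMeasure, Measure.sum_apply _ hs, Measure.smul_apply, smul_eq_mul]
    fun_prop

lemma poissonMeanKernel_apply (r : ℝ) : poissonMeanKernel r = poissonMeasure r.toNNReal := rfl

instance : IsMarkovKernel poissonMeanKernel :=
  ⟨fun r => by rw [poissonMeanKernel_apply]; infer_instance⟩

/-- The map `f` turns a mean and a uniform variable into a Poisson variable with that mean. -/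
structure IsPoissonSampler (f : ℝ → unitInterval → ℕ) : Prop where
  measurable : Measurable (Function.uncurry f)
  map_eq : ∀ r, (volume : Measure unitInterval).map (f r) = poissonMeasure r.toNNReal

/-- A Markov kernel into a standard Borel space can be simulated, jointly measurably, from one
uniform variable. -/
lemma exists_isPoissonSampler : ∃ f, IsPoissonSampler f :=
  let ⟨f, hf, hf'⟩ := poissonMeanKernel.exists_measurable_map_eq_unitInterval
  ⟨f, hf, hf'⟩

/-- The intensity of the Poisson autoregression driven by a sequence of uniform variables. -/
noncomputable def limitIntensity (f : ℝ → unitInterval → ℕ) (c γ β : ℝ) :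
    ℕ → ℝ × (ℕ → unitInterval) → ℝ
  | 0, ω => ω.1
  | t + 1, ω => c + γ * (f (limitIntensity f c γ β t ω) (ω.2 t) : ℝ)
      + β * limitIntensity f c γ β t ω

/-- The counts of the Poisson autoregression driven by a sequence of uniform variables. -/
noncomputable def limitCount (f : ℝ → unitInterval → ℕ) (c γ β : ℝ) (t : ℕ)
    (ω : ℝ × (ℕ → unitInterval)) : ℕ :=
  f (limitIntensity f c γ β t ω) (ω.2 t)

/-- The law of the initial intensity and of independent uniform variables. -/
noncomputable def limitMeasure (ν : Measure ℝ) : Measure (ℝ × (ℕ → unitInterval)) :=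
  ν.prod (Measure.infinitePi fun _ => volume)

instance (ν : Measure ℝ) [IsProbabilityMeasure ν] : IsProbabilityMeasure (limitMeasure ν) := by
  unfold limitMeasure; infer_instance

variable {f : ℝ → unitInterval → ℕ} {c γ β : ℝ}

lemma limitIntensity_succ (t : ℕ) (ω : ℝ × (ℕ → unitInterval)) :
    limitIntensity f c γ β (t + 1) ω =
      c + γ * (limitCount f c γ β t ω : ℝ) + β * limitIntensity f c γ β t ω := rfl

/-- The past of the driving sequence of uniform variables. -/
@[reducible] def limitPast (T : ℕ) : MeasurableSpace (ℝ × (ℕ → unitInterval)) :=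
  pastNoise (fun ω => ω.1) (fun t ω => ω.2 t) T

lemma limitPast_le (T : ℕ) : limitPast T ≤ Prod.instMeasurableSpace :=
  pastNoise_le measurable_fst (fun t => (measurable_pi_apply t).comp measurable_snd) T

lemma limitPast_mono : Monotone limitPast := pastNoise_mono _ _

lemma measurable_limitCount_of (hf : IsPoissonSampler f) {T : ℕ}
    (h : Measurable[limitPast T] (limitIntensity f c γ β T)) :
    Measurable[limitPast (T + 1)] (limitCount f c γ β T) :=
  hf.measurable.comp (Measurable.prodMk (h.mono (limitPast_mono T.le_succ) le_rfl)
    (measurable_noise_pastNoise (fun ω : ℝ × (ℕ → unitInterval) => ω.1) (fun t ω => ω.2 t)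
      T.lt_succ_self))

lemma measurable_limitIntensity (hf : IsPoissonSampler f) (T : ℕ) :
    Measurable[limitPast T] (limitIntensity f c γ β T) := by
  induction T with
  | zero => exact measurable_init_pastNoise _ _ 0
  | succ T ih =>
    have h1 := measurable_limitCount_of hf ih
    have h2 := ih.mono (limitPast_mono T.le_succ) le_rfl
    have h3 : Measurable[limitPast (T + 1)] fun ω => (limitCount f c γ β T ω : ℝ) :=
      (measurable_of_countable (fun n : ℕ => (n : ℝ))).comp h1
    exact ((h3.const_mul γ).const_add c).add (h2.const_mul β)

lemma measurable_limitCount (hf : IsPoissonSampler f) (T : ℕ) :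
    Measurable[limitPast (T + 1)] (limitCount f c γ β T) :=
  measurable_limitCount_of hf (measurable_limitIntensity hf T)

lemma map_snd_limitMeasure (ν : Measure ℝ) [IsProbabilityMeasure ν] :
    (limitMeasure ν).map (fun ω t => ω.2 t) = Measure.infinitePi fun _ => volume := by
  change (limitMeasure ν).map Prod.snd = _
  simp [limitMeasure, Measure.map_snd_prod]

lemma map_limitMeasure_eval (ν : Measure ℝ) [IsProbabilityMeasure ν] (t : ℕ) :
    (limitMeasure ν).map (fun ω => ω.2 t) = volume := by
  have h := Measure.map_map (μ := limitMeasure ν) (g := fun w : ℕ → unitInterval => w t)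
    (f := fun ω t => ω.2 t) (measurable_pi_apply t) measurable_snd
  rw [map_snd_limitMeasure, Measure.infinitePi_map_eval] at h
  exact h.symm

lemma indepFun_limitPast (ν : Measure ℝ) [IsProbabilityMeasure ν] {β' : Type*}
    [MeasurableSpace β'] {T : ℕ} {Y : ℝ × (ℕ → unitInterval) → β'}
    (hY : Measurable[limitPast T] Y) : IndepFun Y (fun ω => ω.2 T) (limitMeasure ν) := by
  refine indepFun_of_measurable_pastNoise (ξ := fun ω : ℝ × (ℕ → unitInterval) => ω.1)
    (V := fun t ω => ω.2 t) measurable_fst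
    (fun t => (measurable_pi_apply t).comp measurable_snd) ?_ ?_ hY
  · refine (iIndepFun_iff_map_fun_eq_infinitePi_map (by fun_prop)).2 ?_
    simp only [map_limitMeasure_eval]
    exact map_snd_limitMeasure ν
  · exact indepFun_prod (X := id) (Y := id) measurable_id measurable_id

/-- Given the past, a count has the Poisson distribution whose mean is the intensity. -/
lemma integral_mul_comp_limitCount (hf : IsPoissonSampler f) (ν : Measure ℝ)
    [IsProbabilityMeasure ν] {T : ℕ} {Y : ℝ × (ℕ → unitInterval) → ℂ}
    (hY : Measurable[limitPast T] Y) {K L : ℝ} (hK : ∀ ω, ‖Y ω‖ ≤ K) (h : ℕ → ℂ)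
    (hL : ∀ n, ‖h n‖ ≤ L) :
    ∫ ω, Y ω * h (limitCount f c γ β T ω) ∂(limitMeasure ν) =
      ∫ ω, Y ω * ∫ n, h n ∂(poissonMeasure (limitIntensity f c γ β T ω).toNNReal)
        ∂(limitMeasure ν) := by
  have hK0 : 0 ≤ K := (norm_nonneg _).trans (hK (0, fun _ => 0))
  let Z : ℝ × (ℕ → unitInterval) → ℂ × ℝ := fun ω => (Y ω, limitIntensity f c γ β T ω)
  have hZ : Measurable[limitPast T] Z := hY.prodMk (measurable_limitIntensity hf T)
  have hfm : ∀ r, Measurable (f r) := fun r => hf.measurable.of_uncurry_left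
  have hg : Measurable fun q : (ℂ × ℝ) × unitInterval => q.1.1 * h (f q.1.2 q.2) := by
    have h1 : Measurable fun q : (ℂ × ℝ) × unitInterval => f q.1.2 q.2 :=
      hf.measurable.comp (by fun_prop : Measurable fun q : (ℂ × ℝ) × unitInterval => (q.1.2, q.2))
    exact Measurable.mul (by fun_prop) ((measurable_of_countable h).comp h1)
  have := integral_comp_of_indepFun (μ := limitMeasure ν) (hZ.mono (limitPast_le T) le_rfl)
    ((measurable_pi_apply T).comp measurable_snd) (indepFun_limitPast ν hZ) hg.stronglyMeasurable
    (K := K * L) (fun ω => by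
      rw [norm_mul]; exact mul_le_mul (hK _) (hL _) (norm_nonneg _) hK0)
  simp only [Z, Function.comp_def, map_limitMeasure_eval] at this
  refine this.trans (integral_congr_ae (Eventually.of_forall fun ω => ?_))
  simp only [integral_const_mul]
  rw [← hf.map_eq, integral_map (hfm _).aemeasurable
    (measurable_of_countable h).aestronglyMeasurable]

/-- This inserts the Poisson characteristic function. The `max` reflects the truncation of negative
means in the sampler; no sign of the intensity is assumed here. -/
lemma integral_mul_expI_limitCount (hf : IsPoissonSampler f) (ν : Measure ℝ)
    [IsProbabilityMeasure ν] {T : ℕ} {Y : ℝ × (ℕ → unitInterval) → ℂ}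
    (hY : Measurable[limitPast T] Y) {K : ℝ} (hK : ∀ ω, ‖Y ω‖ ≤ K) (θ : ℝ) :
    ∫ ω, Y ω * Complex.exp ((θ * limitCount f c γ β T ω : ℝ) * Complex.I) ∂(limitMeasure ν) =
      ∫ ω, Y ω * Complex.exp ((max (limitIntensity f c γ β T ω) 0 : ℝ) *
        (Complex.exp (θ * Complex.I) - 1)) ∂(limitMeasure ν) := by
  have := integral_mul_comp_limitCount (c := c) (γ := γ) (β := β) hf ν hY hK
    (fun n => Complex.exp ((θ * (n : ℝ) : ℝ) * Complex.I)) (L := 1)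
    (fun n => (Complex.norm_exp_ofReal_mul_I _).le)
  refine this.trans (integral_congr_ae (Eventually.of_forall fun ω => ?_))
  have h1 := charFun_map_cast_poissonMeasure (limitIntensity f c γ β T ω).toNNReal θ
  rw [charFun_apply, integral_map .of_discrete (by fun_prop)] at h1
  simp only [Real.inner_apply] at h1
  simp only [mul_comm θ, h1]
  simp

lemma pastInfo_limitCount_le (hf : IsPoissonSampler f) (T : ℕ) :
    pastInfo (limitCount f c γ β) (limitIntensity f c γ β 0) T ≤ limitPast T := by
  refine sup_le ?_ (iSup_le fun s => ?_)
  · exact ((measurable_limitIntensity hf 0).mono (limitPast_mono T.zero_le) le_rfl).comap_le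
  · exact ((measurable_limitCount hf s).mono (limitPast_mono s.2) le_rfl).comap_le

lemma measurable_limitIntensity_pastInfo (T : ℕ) :
    Measurable[pastInfo (limitCount f c γ β) (limitIntensity f c γ β 0) T]
      (limitIntensity f c γ β T) := by
  induction T with
  -- `pastInfo X lam0` unfolds to `pastNoise lam0 X`, so the lemmas on past noise apply with the
  -- counts as noise.
  | zero => exact measurable_init_pastNoise _ (limitCount f c γ β) 0
  | succ T ih =>
    have h1 := measurable_noise_pastNoise (limitIntensity f c γ β 0) (limitCount f c γ β)
      T.lt_succ_self
    have h2 := ih.mono (pastNoise_mono (limitIntensity f c γ β 0) (limitCount f c γ β) T.le_succ)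
      le_rfl
    have h3 : Measurable[pastInfo (limitCount f c γ β) (limitIntensity f c γ β 0) (T + 1)]
        fun ω => (limitCount f c γ β T ω : ℝ) :=
      (measurable_of_countable (fun n : ℕ => (n : ℝ))).comp h1
    exact ((h3.const_mul γ).const_add c).add (h2.const_mul β)

/-- The conditional law given the larger noise past depends only on the intensity, which is already
`pastInfo`-measurable, so it is also the conditional law given `pastInfo`. -/
lemma condExp_limitCount (hf : IsPoissonSampler f) (ν : Measure ℝ) [IsProbabilityMeasure ν]
    (T n : ℕ) :
    (limitMeasure ν)⟦limitCount f c γ β T ⁻¹' {n} |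
      pastInfo (limitCount f c γ β) (limitIntensity f c γ β 0) T⟧ =ᵐ[limitMeasure ν]
    fun ω => (poissonMeasure (limitIntensity f c γ β T ω).toNNReal).real {n} := by
  have hle := pastInfo_limitCount_le (c := c) (γ := γ) (β := β) hf T
  have hle' := hle.trans (limitPast_le T)
  have hX : Measurable (limitCount f c γ β T) :=
    (measurable_limitCount hf T).mono (limitPast_le _) le_rfl
  have hXn : MeasurableSet (limitCount f c γ β T ⁻¹' {n}) := hX (measurableSet_singleton n)
  have hm0 : Measurable fun r : ℝ => (poissonMeasure r.toNNReal).real {n} := by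
    simp only [poissonMeasure_real_singleton]
    fun_prop
  have hgm : Measurable[pastInfo (limitCount f c γ β) (limitIntensity f c γ β 0) T] fun ω =>
      (poissonMeasure (limitIntensity f c γ β T ω).toNNReal).real {n} :=
    hm0.comp (measurable_limitIntensity_pastInfo T)
  have hgi : Integrable (fun ω =>
      (poissonMeasure (limitIntensity f c γ β T ω).toNNReal).real {n}) (limitMeasure ν) :=
    Integrable.of_bound (hgm.mono hle' le_rfl).aestronglyMeasurable 1
      (Eventually.of_forall fun ω => by
        rw [Real.norm_of_nonneg measureReal_nonneg]; exact measureReal_le_one)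
  symm
  refine ae_eq_condExp_of_forall_setIntegral_eq hle' ?_ (fun s _ _ => hgi.integrableOn) ?_
    hgm.stronglyMeasurable.aestronglyMeasurable
  · exact (integrable_const (1 : ℝ)).indicator hXn
  · intro s hs _
    have hs' := hle' s hs
    have hY : Measurable[limitPast T] (s.indicator fun _ => (1 : ℂ)) :=
      measurable_const.indicator (hle s hs)
    have key := integral_mul_comp_limitCount (c := c) (γ := γ) (β := β) hf ν hY (K := 1)
      (fun ω => by by_cases h : ω ∈ s <;> simp [h]) (({n} : Set ℕ).indicator fun _ => (1 : ℂ))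
      (L := 1) (fun m => by by_cases h : m = n <;> simp [h])
    rw [← integral_indicator hs', ← integral_indicator hs']
    have e1 : ∀ ω, (s.indicator (fun _ => (1 : ℂ)) ω) *
        (({n} : Set ℕ).indicator (fun _ => (1 : ℂ)) (limitCount f c γ β T ω)) =
        ((s.indicator ((limitCount f c γ β T ⁻¹' {n}).indicator fun _ => (1 : ℝ)) ω : ℝ) : ℂ) := by
      intro ω
      by_cases h : ω ∈ s <;> by_cases h' : limitCount f c γ β T ω = n <;> simp [h, h']
    have e2 : ∀ ω, (s.indicator (fun _ => (1 : ℂ)) ω) *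
        (∫ m, ({n} : Set ℕ).indicator (fun _ => (1 : ℂ)) m
          ∂(poissonMeasure (limitIntensity f c γ β T ω).toNNReal)) =
        ((s.indicator (fun ω =>
          (poissonMeasure (limitIntensity f c γ β T ω).toNNReal).real {n}) ω : ℝ) : ℂ) := by
      intro ω
      rw [integral_indicator (measurableSet_singleton n)]
      by_cases h : ω ∈ s <;> simp [h, Measure.real]
    simp only [e1, e2] at key
    rw [integral_complex_ofReal, integral_complex_ofReal] at key
    exact_mod_cast key.symm

lemma isPoissonAutoregression_limit (hf : IsPoissonSampler f) (hc : 0 ≤ c) (hγ : 0 ≤ γ)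
    (hβ : 0 ≤ β) (ν : Measure ℝ) [IsProbabilityMeasure ν] (hν : ∀ᵐ r ∂ν, 0 ≤ r) :
    IsPoissonAutoregression (limitMeasure ν) (limitCount f c γ β) (limitIntensity f c γ β)
      c γ β where
  measurable_count t := (measurable_limitCount hf t).mono (limitPast_le _) le_rfl
  measurable_intensity t := (measurable_limitIntensity hf t).mono (limitPast_le _) le_rfl
  intensity_nonneg t := by
    induction t with
    | zero => exact Measure.quasiMeasurePreserving_fst.ae hν
    | succ t ih =>
      filter_upwards [ih] with ω hω
      rw [limitIntensity_succ]
      positivity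
  cond_poisson t n := condExp_limitCount hf ν t n
  intensity_succ t := Eventually.of_forall fun ω => limitIntensity_succ t ω

end LimitProcess

/-! ### Structure of the finite network -/

section Prelimit

/-- Division by the row sum of a zero-one matrix is division by the number of nonzero entries of the
row. -/
lemma IsRowNormalizedAdjacency.apply_le {N : ℕ} {W : Matrix (Fin N) (Fin N) ℝ}
    (hW : IsRowNormalizedAdjacency W) (i j : Fin N) : W i j ≤ 1 / outDegree W i := by
  classical
  obtain ⟨A, hA, hpos, hWA⟩ := hW
  have hdeg : (outDegree W i : ℝ) = ∑ k, A i k := by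
    have h1 : {j : Fin N | W i j ≠ 0} = ↑(Finset.univ.filter fun k => A i k = 1) := by
      ext k
      have := (hpos i).ne'
      rcases hA i k with h | h <;> simp [hWA, h, this]
    have h2 : ∀ k, A i k = if A i k = 1 then 1 else 0 := fun k => by
      rcases hA i k with h | h <;> simp [h]
    rw [outDegree, h1, Set.ncard_coe_finset, Finset.sum_congr rfl fun k _ => h2 k]
    simp
  rw [hWA, hdeg]
  refine div_le_div_of_nonneg_right ?_ (hpos i).le
  rcases hA i j with h | h <;> simp [h]

variable {N : ℕ} {Ω : Type*} [mΩ : MeasurableSpace Ω] {μ : Measure Ω}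
  {w a g b : Fin N → ℝ} {W : Matrix (Fin N) (Fin N) ℝ} {p y u : ℕ → Fin N → Ω → ℝ}

namespace IsNetworkGAB

lemma y_nonneg (h : IsNetworkGAB μ w a g b W p y u) (t : ℕ) (i : Fin N) (x : Ω) :
    0 ≤ y t i x := by
  rw [h.outcome]; split_ifs <;> norm_num

lemma y_le_one (h : IsNetworkGAB μ w a g b W p y u) (t : ℕ) (i : Fin N) (x : Ω) :
    y t i x ≤ 1 := by
  rw [h.outcome]; split_ifs <;> norm_num

lemma p_mem (h : IsNetworkGAB μ w a g b W p y u) (hW : W ∈ doublyStochastic ℝ (Fin N)) (t : ℕ)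
    (i : Fin N) (x : Ω) : p t i x ∈ Set.Icc (0 : ℝ) 1 := by
  induction t with
  | zero => exact h.init_mem i x
  | succ t ih =>
    have h1 : 0 ≤ ∑ j, W i j * y t j x := Finset.sum_nonneg fun j _ =>
      mul_nonneg (nonneg_of_mem_doublyStochastic hW) (h.y_nonneg t j x)
    have h2 : ∑ j, W i j * y t j x ≤ 1 := by
      rw [← sum_row_of_mem_doublyStochastic hW i]
      exact Finset.sum_le_sum fun j _ =>
        mul_le_of_le_one_right (nonneg_of_mem_doublyStochastic hW) (h.y_le_one t j x)
    have e1 := mul_nonneg (h.a_nonneg i) (h.y_nonneg t i x)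
    have e2 := mul_le_of_le_one_right (h.a_nonneg i) (h.y_le_one t i x)
    have e3 := mul_nonneg (h.g_nonneg i) h1
    have e4 := mul_le_of_le_one_right (h.g_nonneg i) h2
    have e5 := mul_nonneg (h.b_nonneg i) ih.1
    have e6 := mul_le_of_le_one_right (h.b_nonneg i) ih.2
    have := h.sum_le_one i
    have := h.w_nonneg i
    rw [h.prob_succ]
    constructor <;> linarith

lemma sum_p_nonneg (h : IsNetworkGAB μ w a g b W p y u) (hW : W ∈ doublyStochastic ℝ (Fin N))
    (t : ℕ) (x : Ω) : 0 ≤ ∑ i, p t i x :=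
  Finset.sum_nonneg fun i _ => (h.p_mem hW t i x).1

lemma sum_y_nonneg (h : IsNetworkGAB μ w a g b W p y u) (t : ℕ) (x : Ω) : 0 ≤ ∑ i, y t i x :=
  Finset.sum_nonneg fun i _ => h.y_nonneg t i x

/-- The σ-algebra generated by the initial probabilities and by the errors before time `T`. -/
@[reducible] def past (p u : ℕ → Fin N → Ω → ℝ) (T : ℕ) : MeasurableSpace Ω :=
  pastNoise (fun x i => p 0 i x) (fun t x i => u t i x) T

lemma measurable_init_pi (h : IsNetworkGAB μ w a g b W p y u) :
    Measurable fun x i => p 0 i x := measurable_pi_lambda _ h.measurable_init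

lemma measurable_error_pi (h : IsNetworkGAB μ w a g b W p y u) (t : ℕ) :
    Measurable fun x i => u t i x := measurable_pi_lambda _ (h.measurable_error t)

lemma past_le (h : IsNetworkGAB μ w a g b W p y u) (T : ℕ) : past p u T ≤ mΩ :=
  pastNoise_le h.measurable_init_pi h.measurable_error_pi T

lemma measurable_y_of (h : IsNetworkGAB μ w a g b W p y u) {T : ℕ}
    (hp : ∀ i, Measurable[past p u T] (p T i)) (i : Fin N) :
    Measurable[past p u (T + 1)] (y T i) := by
  have hu : Measurable[past p u (T + 1)] (u T i) :=
    (measurable_pi_apply i).comp (measurable_noise_pastNoise (fun x i => p 0 i x)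
      (fun t x i => u t i x) T.lt_succ_self)
  have hp' := (hp i).mono (pastNoise_mono (fun x i => p 0 i x) (fun t x i => u t i x) T.le_succ)
    le_rfl
  have : y T i = fun x => if u T i x ≤ p T i x then 1 else 0 := funext (h.outcome T i)
  rw [this]
  exact Measurable.ite (measurableSet_le hu hp') measurable_const measurable_const

lemma measurable_p (h : IsNetworkGAB μ w a g b W p y u) (T : ℕ) (i : Fin N) :
    Measurable[past p u T] (p T i) := by
  induction T generalizing i with
  | zero => exact (measurable_pi_apply i).comp (measurable_init_pastNoise (fun x i => p 0 i x)
      (fun t x i => u t i x) 0)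
  | succ T ih =>
    have hy := fun i => h.measurable_y_of ih i
    have hp := (ih i).mono
      (pastNoise_mono (fun x i => p 0 i x) (fun t x i => u t i x) T.le_succ) le_rfl
    rw [show p (T + 1) i = _ from funext (h.prob_succ T i)]
    exact ((((hy i).const_mul (a i)).const_add (w i)).add
      ((Finset.measurable_fun_sum _ fun j _ => (hy j).const_mul (W i j)).const_mul (g i))).add
      (hp.const_mul (b i))

lemma measurable_y (h : IsNetworkGAB μ w a g b W p y u) (T : ℕ) (i : Fin N) :
    Measurable[past p u (T + 1)] (y T i) := h.measurable_y_of (h.measurable_p T) i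

lemma map_error [IsProbabilityMeasure μ] (h : IsNetworkGAB μ w a g b W p y u) (t : ℕ) :
    μ.map (fun x i => u t i x) =
      Measure.pi fun _ : Fin N => volume.restrict (Set.Icc (0 : ℝ) 1) := by
  have := (h.error_indep.precomp (g := fun i : Fin N => (t, i)) fun i j hij => by simpa using hij)
  rw [iIndepFun_iff_map_fun_eq_pi_map fun i => (h.measurable_error t i).aemeasurable] at this
  simpa only [h.error_uniform] using this

/-- Currying the product law over `ℕ × Fin N` groups the errors into independent vectors, one per
time. -/
lemma iIndepFun_error [IsProbabilityMeasure μ] (h : IsNetworkGAB μ w a g b W p y u) :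
    iIndepFun (fun t x i => u t i x) μ := by
  have hprob : IsProbabilityMeasure ((volume : Measure ℝ).restrict (Set.Icc (0 : ℝ) 1)) :=
    ⟨by simp⟩
  refine (iIndepFun_iff_map_fun_eq_infinitePi_map h.measurable_error_pi).2 ?_
  have hm : Measurable fun x (k : ℕ × Fin N) => u k.1 k.2 x :=
    measurable_pi_lambda _ fun k => h.measurable_error k.1 k.2
  have h1 := (iIndepFun_iff_map_fun_eq_infinitePi_map
    (fun k : ℕ × Fin N => h.measurable_error k.1 k.2)).1 h.error_indep
  simp only [h.error_uniform] at h1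
  have h2 := Measure.infinitePi_map_curry
    (fun (_ : ℕ) (_ : Fin N) => (volume : Measure ℝ).restrict (Set.Icc (0 : ℝ) 1))
  rw [← h1, Measure.map_map (MeasurableEquiv.measurable _) hm] at h2
  simp only [h.map_error, ← Measure.infinitePi_eq_pi]
  exact h2

lemma indepFun_past [IsProbabilityMeasure μ] (h : IsNetworkGAB μ w a g b W p y u)
    {β' : Type*} [MeasurableSpace β'] {T : ℕ} {Y : Ω → β'} (hY : Measurable[past p u T] Y) :
    IndepFun Y (fun x i => u T i x) μ := by
  refine indepFun_of_measurable_pastNoise h.measurable_init_pi h.measurable_error_pi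
    h.iIndepFun_error ?_ hY
  exact h.init_indep.comp (φ := id) (ψ := fun (v : ℕ × Fin N → ℝ) t i => v (t, i))
    measurable_id (by fun_prop)

lemma integral_uniform_ite (z : ℂ) {q : ℝ} (hq : q ∈ Set.Icc (0 : ℝ) 1) :
    ∫ v in Set.Icc (0 : ℝ) 1, (if v ≤ q then z else 1) = 1 + (q : ℂ) * (z - 1) := by
  have h1 : ∀ v : ℝ, (if v ≤ q then z else 1) = (Set.Iic q).indicator (fun _ => z - 1) v + 1 := by
    intro v
    by_cases hv : v ≤ q <;> simp [hv]
  have h2 : Set.Iic q ∩ Set.Icc (0 : ℝ) 1 = Set.Icc 0 q := by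
    ext v
    simp only [Set.mem_inter_iff, Set.mem_Iic, Set.mem_Icc]
    exact ⟨fun hv => ⟨hv.2.1, hv.1⟩, fun hv => ⟨hv.2, hv.1, hv.2.trans hq.2⟩⟩
  simp only [h1]
  rw [integral_add ((integrable_const _).indicator measurableSet_Iic) (integrable_const _),
    integral_indicator measurableSet_Iic, Measure.restrict_restrict measurableSet_Iic, h2]
  simp [hq.1, add_comm]

/-- Given the past, the number of successes is a sum of independent Bernoulli variables. -/
lemma integral_mul_expI_sum_y [IsProbabilityMeasure μ] (h : IsNetworkGAB μ w a g b W p y u)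
    (hW : W ∈ doublyStochastic ℝ (Fin N)) {T : ℕ} {Y : Ω → ℂ} (hY : Measurable[past p u T] Y)
    {K : ℝ} (hK : ∀ x, ‖Y x‖ ≤ K) (θ : ℝ) :
    ∫ x, Y x * Complex.exp ((θ * ∑ i, y T i x : ℝ) * Complex.I) ∂μ =
      ∫ x, Y x * ∏ i, (1 + (p T i x : ℂ) * (Complex.exp (θ * Complex.I) - 1)) ∂μ := by
  set z := Complex.exp (θ * Complex.I) with hz
  have hz1 : ‖z‖ = 1 := Complex.norm_exp_ofReal_mul_I θ
  let Z : Ω → ℂ × (Fin N → ℝ) := fun x => (Y x, fun i => p T i x)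
  have hZ : Measurable[past p u T] Z := hY.prodMk
    (@measurable_pi_lambda Ω (Fin N) (fun _ => ℝ) (past p u T) _ _ (h.measurable_p T))
  -- The exponential of the total is a product over units, each factor being `z` or `1` according to
  -- the error; `G` separates the past from the present errors.
  let G : (ℂ × (Fin N → ℝ)) × (Fin N → ℝ) → ℂ := fun q =>
    q.1.1 * ∏ i, if q.2 i ≤ q.1.2 i then z else 1
  have hG : Measurable G := by
    refine Measurable.mul (by fun_prop) (Finset.measurable_fun_prod _ fun i _ => ?_)
    exact Measurable.ite (measurableSet_le (by fun_prop) (by fun_prop)) measurable_const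
      measurable_const
  have key := integral_comp_of_indepFun (μ := μ) (hZ.mono (h.past_le T) le_rfl)
    (h.measurable_error_pi T) (h.indepFun_past hZ) hG.stronglyMeasurable (K := K * 1)
    (fun x => by
      simp only [G, Z, norm_mul]
      refine mul_le_mul (hK x) (norm_prod_le_one _ _ fun i _ => ?_) (norm_nonneg _)
        ((norm_nonneg _).trans (hK x))
      split_ifs <;> simp [hz1])
  simp only [G, Z, h.map_error, integral_const_mul] at key
  calc ∫ x, Y x * Complex.exp ((θ * ∑ i, y T i x : ℝ) * Complex.I) ∂μ
      = ∫ x, Y x * ∏ i, (if u T i x ≤ p T i x then z else 1) ∂μ := by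
        refine integral_congr_ae (Eventually.of_forall fun x => ?_)
        simp only
        congr 1
        push_cast
        rw [Finset.mul_sum, Finset.sum_mul, Complex.exp_sum]
        refine Finset.prod_congr rfl fun i _ => ?_
        rw [h.outcome]
        split_ifs <;> simp [hz]
    _ = _ := key
    _ = _ := by
        refine integral_congr_ae (Eventually.of_forall fun x => ?_)
        simp only
        congr 1
        rw [integral_fintype_prod_eq_prod (fun (i : Fin N) (v : ℝ) => if v ≤ p T i x then z else 1)]
        exact Finset.prod_congr rfl fun i _ => integral_uniform_ite z (h.p_mem hW T i x)

end IsNetworkGAB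

end Prelimit

/-! ### The Poisson step of the induction -/

section Convergence

/-- The values of a pair of processes at the times before `T`. -/
def pairPath {Ω : Type*} (X L : ℕ → Ω → ℝ) (T : ℕ) (x : Ω) : Fin T → ℝ × ℝ :=
  fun s => (X s x, L s x)

lemma measurable_pairPath {Ω : Type*} {m : MeasurableSpace Ω} {X L : ℕ → Ω → ℝ} {T : ℕ}
    (hX : ∀ s < T, Measurable (X s)) (hL : ∀ s < T, Measurable (L s)) :
    Measurable (pairPath X L T) :=
  measurable_pi_lambda _ fun s => (hX s s.2).prodMk (hL s s.2)

/-- The last count is isolated because it is the only term not determined by the past at time `T`.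
-/
lemma pairing_pairPath_succ {Ω : Type*} (X L : ℕ → Ω → ℝ) (T : ℕ) (θ : Fin (T + 1) → ℝ × ℝ)
    (x : Ω) : pairing θ (pairPath X L (T + 1) x) =
      (pairing (fun s => θ s.castSucc) (pairPath X L T x) + (θ (Fin.last T)).2 * L T x) +
        (θ (Fin.last T)).1 * X T x := by
  simp only [pairing, pairPath, Fin.sum_univ_castSucc, Fin.val_castSucc, Fin.val_last]
  ring

namespace IsNetworkGAB

/-- Exchanging the sums turns the network term into column sums of `W`, all equal to one. -/
lemma sum_p_succ {N : ℕ} {Ω : Type*} [MeasurableSpace Ω] {μ : Measure Ω} {w a : Fin N → ℝ}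
    {γ β : ℝ} {W : Matrix (Fin N) (Fin N) ℝ} {p y u : ℕ → Fin N → Ω → ℝ}
    (h : IsNetworkGAB μ w a (fun _ => γ) (fun _ => β) W p y u)
    (hW : W ∈ doublyStochastic ℝ (Fin N)) (t : ℕ) (x : Ω) :
    ∑ i, p (t + 1) i x =
      ∑ i, w i + ∑ i, a i * y t i x + γ * ∑ i, y t i x + β * ∑ i, p t i x := by
  simp only [h.prob_succ, Finset.sum_add_distrib, ← Finset.mul_sum]
  congr 3
  rw [Finset.sum_comm]
  refine Finset.sum_congr rfl fun j _ => ?_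
  rw [← Finset.sum_mul, sum_col_of_mem_doublyStochastic hW, one_mul]

variable {Ω : ℕ → Type*} [mΩ : ∀ N, MeasurableSpace (Ω N)] {P : (N : ℕ) → Measure (Ω N)}
  {W : (N : ℕ) → Matrix (Fin N) (Fin N) ℝ}
  {p y u : (N : ℕ) → ℕ → Fin N → Ω N → ℝ} {f : ℝ → unitInterval → ℕ} {cbar γ β : ℝ}

/-- The process of the total numbers of successes and total success probabilities. -/
abbrev totals (p y : (N : ℕ) → ℕ → Fin N → Ω N → ℝ) (T N : ℕ) : Ω N → Fin T → ℝ × ℝ :=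
  pairPath (fun t x => ∑ i, y N t i x) (fun t x => ∑ i, p N t i x) T

/-- The limit of the totals. -/
noncomputable abbrev limitTotals (f : ℝ → unitInterval → ℕ) (cbar γ β : ℝ) (T : ℕ) :
    ℝ × (ℕ → unitInterval) → Fin T → ℝ × ℝ :=
  pairPath (fun t ω => (limitCount f cbar γ β t ω : ℝ)) (limitIntensity f cbar γ β) T

lemma measurable_limitTotals (hf : IsPoissonSampler f) (T : ℕ) :
    Measurable[limitPast T] (limitTotals f cbar γ β T) := by
  refine measurable_pairPath (m := limitPast T) (fun s hs => ?_) (fun s hs => ?_)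
  · exact (measurable_of_countable (fun n : ℕ => (n : ℝ))).comp
      ((measurable_limitCount hf s).mono (limitPast_mono hs) le_rfl)
  · exact (measurable_limitIntensity hf s).mono (limitPast_mono hs.le) le_rfl

variable {w a g b : (N : ℕ) → Fin N → ℝ}

lemma measurable_sum_p (h : ∀ N, IsNetworkGAB (P N) (w N) (a N) (g N) (b N) (W N) (p N) (y N)
    (u N)) (T N : ℕ) : Measurable[past (p N) (u N) T] fun x => ∑ i, p N T i x :=
  Finset.measurable_fun_sum _ fun i _ => (h N).measurable_p T i

lemma measurable_totals (h : ∀ N, IsNetworkGAB (P N) (w N) (a N) (g N) (b N) (W N) (p N) (y N)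
    (u N)) (T N : ℕ) : Measurable[past (p N) (u N) T] (totals p y T N) := by
  have hmono := pastNoise_mono (fun x i => p N 0 i x) (fun t x i => u N t i x)
  refine measurable_pairPath (m := past (p N) (u N) T) (fun s hs => ?_) (fun s hs => ?_)
  · exact Finset.measurable_fun_sum _ fun i _ => ((h N).measurable_y s i).mono (hmono hs) le_rfl
  · exact (measurable_sum_p h s N).mono (hmono hs.le) le_rfl

variable [∀ N, IsProbabilityMeasure (P N)] {ν : Measure ℝ} [IsProbabilityMeasure ν]

/-- One step of the induction: the number of successes is asymptotically Poisson. -/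
lemma tendstoInDistribution_totals_succ
    (h : ∀ N, IsNetworkGAB (P N) (w N) (a N) (g N) (b N) (W N) (p N) (y N) (u N))
    (hW : ∀ N, W N ∈ doublyStochastic ℝ (Fin N)) (hf : IsPoissonSampler f) {T : ℕ}
    (hmax : SmallInProb P fun N x => ⨆ i, p N T i x)
    (hT : TendstoInDistribution (fun N x => (totals p y T N x, ∑ i, p N T i x)) atTop
      (fun ω => (limitTotals f cbar γ β T ω, limitIntensity f cbar γ β T ω)) P (limitMeasure ν)) :
    TendstoInDistribution (totals p y (T + 1)) atTop (limitTotals f cbar γ β (T + 1)) P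
      (limitMeasure ν) := by
  refine tendstoInDistribution_of_charFun_pairs
    (fun N => ((measurable_totals h (T + 1) N).mono ((h N).past_le _) le_rfl).aemeasurable)
    ((measurable_limitTotals hf (T + 1)).mono (limitPast_le _) le_rfl).aemeasurable fun θ => ?_
  set θ' : Fin T → ℝ × ℝ := fun s => θ s.castSucc
  set η := (θ (Fin.last T)).2
  set τ := (θ (Fin.last T)).1
  -- `A` collects the factors known before the errors at time `T`, `B` is the conditional Bernoulli
  -- characteristic function, and `E` the Poisson one.
  let A : (Fin T → ℝ × ℝ) × ℝ → ℂ := fun q =>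
    Complex.exp ((pairing θ' q.1 + η * q.2 : ℝ) * Complex.I)
  have hA : Continuous A := by fun_prop
  have hA1 : ∀ q, ‖A q‖ ≤ 1 := fun q => (Complex.norm_exp_ofReal_mul_I _).le
  let E : ℝ → ℂ := fun l => Complex.exp (l * (Complex.exp (τ * Complex.I) - 1))
  have hE1 : ∀ {l : ℝ}, 0 ≤ l → ‖E l‖ ≤ 1 := fun hl => norm_exp_mul_expI_sub_one_le τ hl
  have hEc : Continuous E := by fun_prop
  let B : (N : ℕ) → Ω N → ℂ := fun N x =>
    ∏ i, (1 + (p N T i x : ℂ) * (Complex.exp (τ * Complex.I) - 1))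
  let S : (N : ℕ) → Ω N → (Fin T → ℝ × ℝ) × ℝ := fun N x => (totals p y T N x, ∑ i, p N T i x)
  let S' : ℝ × (ℕ → unitInterval) → (Fin T → ℝ × ℝ) × ℝ := fun ω =>
    (limitTotals f cbar γ β T ω, limitIntensity f cbar γ β T ω)
  have hS : ∀ N, Measurable[past (p N) (u N) T] (S N) := fun N =>
    (measurable_totals h T N).prodMk (measurable_sum_p h T N)
  have hS' : Measurable[limitPast T] S' :=
    (measurable_limitTotals hf T).prodMk (measurable_limitIntensity hf T)
  have hp0 : ∀ N i x, 0 ≤ p N T i x := fun N i x => ((h N).p_mem (hW N) T i x).1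
  have hp1 : ∀ N i x, p N T i x ≤ 1 := fun N i x => ((h N).p_mem (hW N) T i x).2
  have hL0 : ∀ N x, 0 ≤ ∑ i, p N T i x := fun N x => (h N).sum_p_nonneg (hW N) T x
  have hBm : ∀ N, Measurable (B N) := fun N => by
    have hp : ∀ i, Measurable (p N T i) := fun i =>
      ((h N).measurable_p T i).mono ((h N).past_le T) le_rfl
    exact Finset.measurable_fun_prod _ fun i _ => by fun_prop
  have hB1 : ∀ N x, ‖B N x‖ ≤ 1 := fun N x => norm_prod_le_one _ _ fun i _ =>
    norm_one_add_mul_expI_sub_one_le τ (hp0 N i x) (hp1 N i x)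
  have hSm : ∀ N, Measurable (S N) := fun N => (hS N).mono ((h N).past_le T) le_rfl
  have hAS : ∀ N, Measurable fun x => A (S N x) := fun N => hA.measurable.comp (hSm N)
  have hES : ∀ N, Measurable fun x => E (S N x).2 := fun N =>
    hEc.measurable.comp (hSm N).snd
  have hE1' : ∀ N x, ‖E (S N x).2‖ ≤ 1 := fun N x => hE1 (hL0 N x)
  have hlhs : ∀ N, ∫ x, Complex.exp (pairing θ (totals p y (T + 1) N x) * Complex.I) ∂(P N) =
      ∫ x, A (S N x) * B N x ∂(P N) := fun N => by
    refine Eq.trans (integral_congr_ae (Eventually.of_forall fun x => ?_))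
      ((h N).integral_mul_expI_sum_y (hW N) (hA.measurable.comp (hS N)) (fun x => hA1 _) τ)
    simp only [pairing_pairPath_succ, Complex.ofReal_add, add_mul, Complex.exp_add, A, S,
      Function.comp]
    rfl
  have hrhs : ∫ ω, Complex.exp (pairing θ (limitTotals f cbar γ β (T + 1) ω) * Complex.I)
        ∂(limitMeasure ν) = ∫ ω, A (S' ω) * E (max (S' ω).2 0) ∂(limitMeasure ν) := by
    have := integral_mul_expI_limitCount (c := cbar) (γ := γ) (β := β) hf ν
      (hA.measurable.comp hS') (fun x => hA1 _) τ
    refine Eq.trans (integral_congr_ae (Eventually.of_forall fun x => ?_)) this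
    simp only [pairing_pairPath_succ, Complex.ofReal_add, add_mul, Complex.exp_add, A, S',
      Function.comp]
    rfl
  rw [hrhs]
  simp only [hlhs]
  have hmain : Tendsto (fun N => ∫ x, A (S N x) * E (max (S N x).2 0) ∂(P N)) atTop
      (𝓝 (∫ ω, A (S' ω) * E (max (S' ω).2 0) ∂(limitMeasure ν))) :=
    hT.tendsto_integral (G := fun q => A q * E (max q.2 0)) (by fun_prop) (B := 1) fun q => by
      rw [norm_mul]
      exact mul_le_one₀ (hA1 q) (norm_nonneg _) (hE1 (le_max_right _ _))
  have hdiff : Tendsto (fun N => ∫ x, A (S N x) * (B N x - E (S N x).2) ∂(P N)) atTop (𝓝 0) := by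
    refine tendsto_integral_of_smallInProb (B := 2)
      (fun N => ((hAS N).mul ((hBm N).sub (hES N))).aestronglyMeasurable) (fun N x => ?_) ?_
    · rw [norm_mul]
      have h1 := norm_sub_le (B N x) (E (S N x).2)
      nlinarith [hA1 (S N x), hB1 N x, hE1' N x, norm_nonneg (A (S N x)),
        norm_nonneg (B N x - E (S N x).2)]
    · refine ((hmax.mul_tendstoInDistribution (hT.continuous_comp continuous_snd) hL0).const_mul
        (K := 8) (by norm_num)).mono (Eventually.of_forall fun N x => ?_)
      have h1 : ‖B N x - E (S N x).2‖ ≤ 8 * (⨆ i, p N T i x) * ∑ i, p N T i x :=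
        norm_prod_one_add_sub_exp_le τ (fun i => hp0 N i x) (fun i => hp1 N i x)
          fun i => le_ciSup (f := fun i => p N T i x) (Set.finite_range _).bddAbove i
      rw [norm_mul]
      calc ‖A (S N x)‖ * ‖B N x - E (S N x).2‖ ≤ 1 * ‖B N x - E (S N x).2‖ :=
            mul_le_mul_of_nonneg_right (hA1 _) (norm_nonneg _)
        _ ≤ _ := by rw [one_mul, ← mul_assoc]; exact h1
  have := hdiff.add hmain
  rw [zero_add] at this
  refine this.congr fun N => ?_
  have i1 : Integrable (fun x => A (S N x) * (B N x - E (S N x).2)) (P N) :=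
    Integrable.of_bound ((hAS N).mul ((hBm N).sub (hES N))).aestronglyMeasurable (1 * (1 + 1))
      (Eventually.of_forall fun x => by
        rw [norm_mul]
        exact mul_le_mul (hA1 _) ((norm_sub_le _ _).trans (add_le_add (hB1 N x) (hE1' N x)))
          (norm_nonneg _) zero_le_one)
  have hmaxL : ∀ x, max (S N x).2 0 = (S N x).2 := fun x => max_eq_left (hL0 N x)
  simp only [hmaxL]
  have i2 : Integrable (fun x => A (S N x) * E (S N x).2) (P N) :=
    Integrable.of_bound ((hAS N).mul (hES N)).aestronglyMeasurable (1 * 1)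
      (Eventually.of_forall fun x => by
        rw [norm_mul]
        exact mul_le_mul (hA1 _) (hE1' N x) (norm_nonneg _) zero_le_one)
  rw [← integral_add i1 i2]
  refine integral_congr_ae (Eventually.of_forall fun x => ?_)
  ring

end IsNetworkGAB

end Convergence

/-! ### Propagation of the hypotheses in time and the induction -/

section Sparse

namespace IsNetworkGAB

lemma sum_weight_mul_y_le {N : ℕ} {Ω : Type*} [MeasurableSpace Ω] {μ : Measure Ω}
    {w a g b : Fin N → ℝ} {W : Matrix (Fin N) (Fin N) ℝ} {p y u : ℕ → Fin N → Ω → ℝ}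
    (h : IsNetworkGAB μ w a g b W p y u) {D : ℝ} (hD : 0 < D) {i : Fin N}
    (hi : D ≤ outDegree W i) (t : ℕ) (x : Ω) :
    ∑ j, W i j * y t j x ≤ 1 / D * ∑ j, y t j x := by
  rw [Finset.mul_sum]
  exact Finset.sum_le_sum fun j _ => mul_le_mul_of_nonneg_right
    ((h.network.apply_le i j).trans (one_div_le_one_div_of_le hD hi)) (h.y_nonneg t j x)

variable {Ω : ℕ → Type*} [mΩ : ∀ N, MeasurableSpace (Ω N)] {P : (N : ℕ) → Measure (Ω N)}
  [∀ N, IsProbabilityMeasure (P N)] {W : (N : ℕ) → Matrix (Fin N) (Fin N) ℝ}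
  {c a : (N : ℕ) → Fin N → ℝ} {p y u : (N : ℕ) → ℕ → Fin N → Ω N → ℝ} {C κ γ β d cbar : ℝ}
  {Ω' : Type*} [MeasurableSpace Ω'] {Q : Measure Ω'} [IsProbabilityMeasure Q]

lemma tendsto_div_rpow_zero (C : ℝ) (hκ : 0 < κ) :
    Tendsto (fun N : ℕ => C / (N : ℝ) ^ κ) atTop (𝓝 0) :=
  tendsto_const_nhds.div_atTop ((tendsto_rpow_atTop hκ).comp tendsto_natCast_atTop_atTop)

/-- The largest success probability stays small, since the sums over neighbours are averages
over many units. -/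
lemma smallInProb_iSup_succ
    (h : ∀ N, IsNetworkGAB (P N) (fun i => c N i / (N : ℝ)) (fun i => a N i / (N : ℝ) ^ κ)
      (fun _ => γ) (fun _ => β) (W N) (p N) (y N) (u N))
    (hW : ∀ N, W N ∈ doublyStochastic ℝ (Fin N)) (hκ : 0 < κ) (hd : 0 < d) (hγ : 0 ≤ γ)
    (hc : ∀ N i, 0 ≤ c N i ∧ c N i ≤ C) (ha : ∀ N i, 0 ≤ a N i ∧ a N i ≤ C)
    (hdeg : ∀ (N : ℕ) (i : Fin N), d * Real.log N ≤ outDegree (W N) i) {T : ℕ}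
    {X : Ω' → ℝ} (hX : TendstoInDistribution (fun N x => ∑ i, y N T i x) atTop X P Q)
    (hmax : SmallInProb P fun N x => ⨆ i, p N T i x) :
    SmallInProb P fun N x => ⨆ i, p N (T + 1) i x := by
  have hlog : Tendsto (fun N : ℕ => γ * (1 / (d * Real.log N))) atTop (𝓝 0) := by
    have : Tendsto (fun N : ℕ => d * Real.log N) atTop atTop :=
      (Real.tendsto_log_atTop.comp tendsto_natCast_atTop_atTop).const_mul_atTop hd
    simpa using (tendsto_const_nhds.div_atTop this : Tendsto (fun N : ℕ =>
      (1 : ℝ) / (d * Real.log N)) atTop (𝓝 0)).const_mul γ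
  have hdet : Tendsto (fun N : ℕ => C / (N : ℝ) + C / (N : ℝ) ^ κ) atTop (𝓝 0) := by
    simpa using (tendsto_const_nhds.div_atTop tendsto_natCast_atTop_atTop).add
      (tendsto_div_rpow_zero C hκ)
  refine (((smallInProb_of_tendsto hdet).add ((smallInProb_of_tendsto hlog).mul_tendstoInDistribution
    hX fun N x => (h N).sum_y_nonneg T x)).add hmax).mono ?_
  -- From `N = 2` on, `log N` is positive, so the degree bound can be inverted.
  filter_upwards [eventually_ge_atTop 2] with N hN x
  have hN0 : (0 : ℝ) < N := by positivity
  have : Nonempty (Fin N) := ⟨⟨0, by omega⟩⟩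
  have hlogpos : 0 < d * Real.log N := mul_pos hd (Real.log_pos (by exact_mod_cast hN))
  refine ciSup_le fun i => ?_
  have hp := (h N).p_mem (hW N) T i x
  have hβ1 : β ≤ 1 := by
    have h1 := (h N).sum_le_one i
    have h2 := (h N).w_nonneg i
    have h3 := (h N).a_nonneg i
    linarith
  have e1 : c N i / (N : ℝ) ≤ C / N := div_le_div_of_nonneg_right (hc N i).2 hN0.le
  have e2 : a N i / (N : ℝ) ^ κ * y N T i x ≤ C / (N : ℝ) ^ κ :=
    (mul_le_of_le_one_right ((h N).a_nonneg i) ((h N).y_le_one T i x)).trans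
      (div_le_div_of_nonneg_right (ha N i).2 (by positivity))
  have e3 := mul_le_mul_of_nonneg_left
    ((h N).sum_weight_mul_y_le hlogpos (hdeg N i) T x) hγ
  have e4 : β * p N T i x ≤ ⨆ i, p N T i x := (mul_le_of_le_one_left hp.1 hβ1).trans
    (le_ciSup (f := fun i => p N T i x) (Set.finite_range _).bddAbove i)
  rw [(h N).prob_succ]
  rw [← mul_assoc] at e3
  linarith

/-- The total success probability asymptotically satisfies the recursion of the limit. -/
lemma smallInProb_sum_p_succ_sub
    (h : ∀ N, IsNetworkGAB (P N) (fun i => c N i / (N : ℝ)) (fun i => a N i / (N : ℝ) ^ κ)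
      (fun _ => γ) (fun _ => β) (W N) (p N) (y N) (u N))
    (hW : ∀ N, W N ∈ doublyStochastic ℝ (Fin N)) (hκ : 0 < κ)
    (ha : ∀ N i, 0 ≤ a N i ∧ a N i ≤ C)
    (hcbar : Tendsto (fun N : ℕ => (1 / (N : ℝ)) * ∑ i, c N i) atTop (𝓝 cbar)) {T : ℕ}
    {X : Ω' → ℝ} (hX : TendstoInDistribution (fun N x => ∑ i, y N T i x) atTop X P Q) :
    SmallInProb P fun N x =>
      ‖∑ i, p N (T + 1) i x - (cbar + γ * ∑ i, y N T i x + β * ∑ i, p N T i x)‖ := by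
  have hdet : Tendsto (fun N : ℕ => ‖(1 / (N : ℝ)) * ∑ i, c N i - cbar‖) atTop (𝓝 0) := by
    simpa using (hcbar.sub_const cbar).norm
  refine ((smallInProb_of_tendsto hdet).add ((smallInProb_of_tendsto
    (tendsto_div_rpow_zero C hκ)).mul_tendstoInDistribution
    hX fun N x => (h N).sum_y_nonneg T x)).mono (Eventually.of_forall fun N x => ?_)
  rw [(h N).sum_p_succ (hW N)]
  have e1 : ∑ i, c N i / (N : ℝ) = (1 / (N : ℝ)) * ∑ i, c N i := by
    rw [← Finset.sum_div]; ring
  have e2 : 0 ≤ ∑ i, a N i / (N : ℝ) ^ κ * y N T i x := Finset.sum_nonneg fun i _ =>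
    mul_nonneg ((h N).a_nonneg i) ((h N).y_nonneg T i x)
  have e3 : ∑ i, a N i / (N : ℝ) ^ κ * y N T i x ≤ C / (N : ℝ) ^ κ * ∑ i, y N T i x := by
    rw [Finset.mul_sum]
    exact Finset.sum_le_sum fun i _ => mul_le_mul_of_nonneg_right
      (div_le_div_of_nonneg_right (ha N i).2 (by positivity)) ((h N).y_nonneg T i x)
  rw [e1]
  calc _ = ‖((1 / (N : ℝ)) * ∑ i, c N i - cbar) + ∑ i, a N i / (N : ℝ) ^ κ * y N T i x‖ := by
        congr 1; ring
    _ ≤ ‖(1 / (N : ℝ)) * ∑ i, c N i - cbar‖ + ‖∑ i, a N i / (N : ℝ) ^ κ * y N T i x‖ :=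
        norm_add_le _ _
    _ ≤ _ := by rw [Real.norm_of_nonneg e2]; gcongr

lemma tendstoInDistribution_totals
    (h : ∀ N, IsNetworkGAB (P N) (fun i => c N i / (N : ℝ)) (fun i => a N i / (N : ℝ) ^ κ)
      (fun _ => γ) (fun _ => β) (W N) (p N) (y N) (u N))
    (hW : ∀ N, W N ∈ doublyStochastic ℝ (Fin N)) (hκ : 0 < κ) (hd : 0 < d) (hγ : 0 ≤ γ)
    (hc : ∀ N i, 0 ≤ c N i ∧ c N i ≤ C) (ha : ∀ N i, 0 ≤ a N i ∧ a N i ≤ C)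
    (hdeg : ∀ (N : ℕ) (i : Fin N), d * Real.log N ≤ outDegree (W N) i)
    (hcbar : Tendsto (fun N : ℕ => (1 / (N : ℝ)) * ∑ i, c N i) atTop (𝓝 cbar))
    {f : ℝ → unitInterval → ℕ} (hf : IsPoissonSampler f) {ν : Measure ℝ}
    [IsProbabilityMeasure ν]
    (hinit : TendstoInDistribution (fun N x => ∑ i, p N 0 i x) atTop (fun ω => ω.1) P (limitMeasure ν))
    (hmax : SmallInProb P fun N x => ⨆ i, p N 0 i x) (T : ℕ) :
    TendstoInDistribution (totals p y T) atTop (limitTotals f cbar γ β T) P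
      (limitMeasure ν) := by
  have step : ∀ T : ℕ,
      TendstoInDistribution (totals p y (T + 1)) atTop (limitTotals f cbar γ β (T + 1)) P
        (limitMeasure ν) →
      SmallInProb P (fun N x => ⨆ i, p N T i x) →
      TendstoInDistribution (fun N x => (totals p y (T + 1) N x, ∑ i, p N (T + 1) i x)) atTop
        (fun ω => (limitTotals f cbar γ β (T + 1) ω, limitIntensity f cbar γ β (T + 1) ω)) P
        (limitMeasure ν) ∧ SmallInProb P (fun N x => ⨆ i, p N (T + 1) i x) := by
    intro T hV hm
    have hX : TendstoInDistribution (fun N x => ∑ i, y N T i x) atTop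
        (fun ω => (limitCount f cbar γ β T ω : ℝ)) P (limitMeasure ν) :=
      hV.continuous_comp (g := fun v : Fin (T + 1) → ℝ × ℝ => (v (Fin.last T)).1) (by fun_prop)
    refine ⟨?_, smallInProb_iSup_succ h hW hκ hd hγ hc ha hdeg hX hm⟩
    -- With `cbar` in place of the finite-`N` inputs, the next intensity is a continuous function of
    -- the totals so far; Slutsky's theorem then restores the true one.
    have hV' : TendstoInDistribution (fun N x => (totals p y (T + 1) N x,
        cbar + γ * ∑ i, y N T i x + β * ∑ i, p N T i x)) atTop
        (fun ω => (limitTotals f cbar γ β (T + 1) ω, limitIntensity f cbar γ β (T + 1) ω)) P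
        (limitMeasure ν) :=
      hV.continuous_comp (g := fun v : Fin (T + 1) → ℝ × ℝ =>
        (v, cbar + γ * (v (Fin.last T)).1 + β * (v (Fin.last T)).2)) (by fun_prop)
    refine hV'.of_smallInProb_sub (fun N => ?_) ?_
    · exact (((measurable_totals h (T + 1) N).prodMk (measurable_sum_p h (T + 1) N)).mono
        ((h N).past_le _) le_rfl).aemeasurable
    · refine (smallInProb_sum_p_succ_sub h hW hκ ha hcbar hX).mono
        (Eventually.of_forall fun N x => ?_)
      rw [Prod.mk_sub_mk, sub_self, Prod.norm_mk, norm_zero]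
      exact max_le (norm_nonneg _) le_rfl
  have main : ∀ T : ℕ,
      TendstoInDistribution (fun N x => (totals p y T N x, ∑ i, p N T i x)) atTop
        (fun ω => (limitTotals f cbar γ β T ω, limitIntensity f cbar γ β T ω)) P
        (limitMeasure ν) ∧ SmallInProb P (fun N x => ⨆ i, p N T i x) := by
    intro T
    induction T with
    | zero =>
      refine ⟨?_, hmax⟩
      have := hinit.continuous_comp (g := fun r => ((fun s => s.elim0 : Fin 0 → ℝ × ℝ), r))
        (by fun_prop)
      convert this using 1
      · ext N x s
        · exact s.elim0
        · exact s.elim0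
        · rfl
      · ext ω s
        · exact s.elim0
        · exact s.elim0
        · rfl
    | succ T ih => exact step T (tendstoInDistribution_totals_succ h hW hf ih.2 ih.1) ih.2
  have := (main T).1.continuous_comp continuous_fst
  exact this

end IsNetworkGAB

end Sparse

/-! ### Transfer of the limit and conclusion -/

lemma MeasureTheory.TendstoInDistribution.of_map_eq {Ω : ℕ → Type*} [∀ N, MeasurableSpace (Ω N)]
    {P : (N : ℕ) → Measure (Ω N)} [∀ N, IsProbabilityMeasure (P N)] {Ω₁ Ω₂ E : Type*}
    [MeasurableSpace Ω₁] [MeasurableSpace Ω₂] {Q₁ : Measure Ω₁} {Q₂ : Measure Ω₂}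
    [IsProbabilityMeasure Q₁] [IsProbabilityMeasure Q₂] [TopologicalSpace E] [MeasurableSpace E]
    [OpensMeasurableSpace E] {Z : (N : ℕ) → Ω N → E} {Z₁ : Ω₁ → E} {Z₂ : Ω₂ → E}
    (h : TendstoInDistribution Z atTop Z₁ P Q₁) (hZ₂ : AEMeasurable Z₂ Q₂)
    (heq : Q₂.map Z₂ = Q₁.map Z₁) : TendstoInDistribution Z atTop Z₂ P Q₂ := by
  refine ⟨h.forall_aemeasurable, hZ₂, ?_⟩
  have : (⟨Q₂.map Z₂, Measure.isProbabilityMeasure_map hZ₂⟩ : ProbabilityMeasure E) =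
      ⟨Q₁.map Z₁, Measure.isProbabilityMeasure_map h.aemeasurable_limit⟩ := Subtype.ext heq
  exact this ▸ h.tendsto

lemma tendstoFDD_of_forall_pairPath {Ω : ℕ → Type*} [∀ N, MeasurableSpace (Ω N)]
    {P : (N : ℕ) → Measure (Ω N)} [∀ N, IsProbabilityMeasure (P N)] {Ω' : Type*}
    [MeasurableSpace Ω'] {Q : Measure Ω'} [IsProbabilityMeasure Q]
    {X L : (N : ℕ) → ℕ → Ω N → ℝ} {X' L' : ℕ → Ω' → ℝ}
    (h : ∀ T, TendstoInDistribution (fun N => pairPath (X N) (L N) T) atTop (pairPath X' L' T) P Q)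
    {E : Type*} [TopologicalSpace E] [SecondCountableTopology E] [MeasurableSpace E]
    [BorelSpace E] {g : ℝ × ℝ → E} (hg : Continuous g) :
    TendstoFDD (fun N t x => g (X N t x, L N t x)) (fun t x => g (X' t x, L' t x)) P Q := by
  intro I
  -- A path of length `T` records the times strictly below `T`, hence the `+ 1` to include the
  -- largest time in `I`.
  have hlt : ∀ t : I, (t : ℕ) < I.sup id + 1 := fun t =>
    Nat.lt_succ_of_le (Finset.le_sup (f := id) t.2)
  exact (h (I.sup id + 1)).continuous_comp (g := fun v (t : I) => g (v ⟨t, hlt t⟩)) (by fun_prop)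

/-- The portmanteau inequality for the open negative half-line, which has mass zero for every `N`.
-/
lemma ae_nonneg_of_tendstoInDistribution {Ω : ℕ → Type*} [∀ N, MeasurableSpace (Ω N)]
    {P : (N : ℕ) → Measure (Ω N)} [∀ N, IsProbabilityMeasure (P N)] {Ω' : Type*}
    [MeasurableSpace Ω'] {Q : Measure Ω'} [IsProbabilityMeasure Q]
    {Z : (N : ℕ) → Ω N → ℝ} {Z' : Ω' → ℝ} (h : TendstoInDistribution Z atTop Z' P Q)
    (hZ : ∀ N x, 0 ≤ Z N x) : ∀ᵐ r ∂(Q.map Z'), 0 ≤ r := by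
  have h1 := ProbabilityMeasure.le_liminf_measure_open_of_tendsto h.tendsto
    (G := Set.Iio (0 : ℝ)) isOpen_Iio
  have h2 : ∀ N, ((P N).map (Z N)) (Set.Iio (0 : ℝ)) = 0 := fun N => by
    rw [Measure.map_apply_of_aemeasurable (h.forall_aemeasurable N) measurableSet_Iio]
    convert measure_empty (μ := P N)
    ext x
    simp [hZ N x]
  simp only [ProbabilityMeasure.coe_mk, h2, liminf_const] at h1
  rw [ae_iff]
  convert le_antisymm h1 zero_le using 2
  ext r
  simp

theorem mainTheorem3
    {Ω : ℕ → Type*} [∀ N, MeasurableSpace (Ω N)]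
    (P : (N : ℕ) → Measure (Ω N)) [∀ N, IsProbabilityMeasure (P N)]
    {Ω₀ : Type*} [MeasurableSpace Ω₀] (P₀ : Measure Ω₀) [IsProbabilityMeasure P₀]
    (W : (N : ℕ) → Matrix (Fin N) (Fin N) ℝ)
    (c a : (N : ℕ) → Fin N → ℝ) (C κ β γ d cbar : ℝ)
    (p y u : (N : ℕ) → ℕ → Fin N → Ω N → ℝ) (lam₀ : Ω₀ → ℝ)
    (hκ : 0 < κ) (hd : 0 < d) (hβ : 0 ≤ β) (hγ : 0 ≤ γ)
    (hc : ∀ N i, 0 ≤ c N i ∧ c N i ≤ C)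
    (ha : ∀ N i, 0 ≤ a N i ∧ a N i ≤ C)
    (hmodel : ∀ N, IsNetworkGAB (P N) (fun i => c N i / (N : ℝ))
      (fun i => a N i / (N : ℝ) ^ κ) (fun _ => γ) (fun _ => β) (W N) (p N) (y N) (u N))
    (hW : ∀ N, W N ∈ doublyStochastic ℝ (Fin N))
    (hdeg : ∀ (N : ℕ) (i : Fin N), d * Real.log N ≤ outDegree (W N) i)
    (hcbar : Tendsto (fun N : ℕ => (1 / (N : ℝ)) * ∑ i, c N i) atTop (𝓝 cbar))
    (hlam₀ : Integrable lam₀ P₀)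
    (hinit_dist : TendstoInDistribution (fun N x => ∑ i, p N 0 i x) atTop lam₀ P P₀)
    (hinit_mean : Tendsto (fun N => ∑ i, ∫ x, p N 0 i x ∂(P N)) atTop (𝓝 (∫ x, lam₀ x ∂P₀)))
    (hinit_max : ∀ ε : ℝ, 0 < ε →
      Tendsto (fun N => P N {x | ε ≤ ⨆ i, p N 0 i x}) atTop (𝓝 0)) :
    ∃ (Ω' : Type) (_ : MeasurableSpace Ω') (Q : Measure Ω') (_ : IsProbabilityMeasure Q)
      (X : ℕ → Ω' → ℕ) (lam : ℕ → Ω' → ℝ),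
      IsPoissonAutoregression Q X lam cbar γ β ∧
      IdentDistrib (lam 0) lam₀ Q P₀ ∧
      TendstoFDD (fun N t x => ∑ i, y N t i x) (fun t x => (X t x : ℝ)) P Q ∧
      TendstoFDD (fun N t x => (∑ i, y N t i x, ∑ i, p N t i x))
        (fun t x => ((X t x : ℝ), lam t x)) P Q := by
  obtain ⟨f, hf⟩ := exists_isPoissonSampler
  have hlam := hinit_dist.aemeasurable_limit
  have hν : IsProbabilityMeasure (P₀.map lam₀) := Measure.isProbabilityMeasure_map hlam
  have hcbar0 : 0 ≤ cbar := ge_of_tendsto' hcbar fun N =>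
    mul_nonneg (by positivity) (Finset.sum_nonneg fun i _ => (hc N i).1)
  have hfst : (limitMeasure (P₀.map lam₀)).map (fun ω => ω.1) = P₀.map lam₀ := by
    change (limitMeasure (P₀.map lam₀)).map Prod.fst = _
    simp [limitMeasure, Measure.map_fst_prod]
  -- Only the law of the limit matters, so `lam₀` is replaced by the first coordinate of the
  -- constructed space.
  have hinit := hinit_dist.of_map_eq measurable_fst.aemeasurable hfst
  have htot := IsNetworkGAB.tendstoInDistribution_totals hmodel hW hκ hd hγ hc ha hdeg hcbar hf
    hinit hinit_max
  refine ⟨ℝ × (ℕ → unitInterval), inferInstance, limitMeasure (P₀.map lam₀), inferInstance,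
    limitCount f cbar γ β, limitIntensity f cbar γ β, ?_, ?_, ?_, ?_⟩
  · exact isPoissonAutoregression_limit hf hcbar0 hγ hβ _
      (ae_nonneg_of_tendstoInDistribution hinit_dist fun N x =>
        (hmodel N).sum_p_nonneg (hW N) 0 x)
  · refine ⟨((measurable_limitIntensity hf 0).mono (limitPast_le 0) le_rfl).aemeasurable, hlam,
      hfst⟩
  · exact tendstoFDD_of_forall_pairPath htot continuous_fst
  · exact tendstoFDD_of_forall_pairPath htot continuous_id
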